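/- Let $n\ge 2$, let $m\ge 1$ be odd, and put $h=2^{n-1}m$. Let $\mathbb{D}_h$ be the central division algebra over $\mathbb{Q}_2$ of dimension $h^2$ and Hasse invariant $1/h$, with its absolute value extending the $2$-adic one, let $\mathcal{O}_h\subset\mathbb{D}_h$ be its maximal order (the valuation ring), and let $\mathcal{O}_h^\times$ be its group of units, the small Morava stabilizer group at the prime $2$ and height $h$. It is open in $\mathbb{D}_h$ and so is a $2$-adic Lie group. Let $\mathbb{G}$ be a $2$-adic Lie group that contains $\mathcal{O}_h^\times$ as an open Lie subgroup (for example $\mathcal{O}_h^\times$ itself, or an extended Morava stabilizer group $\mathbb{G}_h\cong\mathcal{O}_h^\times\rtimes\mathrm{Gal}(k/\mathbb{F}_2)$ with $k$ finite). Let $C_{2^n}\le\mathcal{O}_h^\times$ be a cyclic subgroup of order $2^n$, let $C_2$ be its subgroup of order $2$, and let $\sigma$ be the sign representation of $C_2$. For a field $F$ let $\rho_F=F[C_{2^n}]$ be the regular representation. (1) Let $V$ be the Lie algebra of $\mathbb{G}$, a $\mathbb{Q}_2$-vector space, with the adjoint action of $C_{2^n}$. Then $$V\;\cong\;2^{n-1}m^2\bigl(\rho_{\mathbb{Q}_2}-\mathrm{Ind}_{C_2}^{C_{2^n}}\sigma\bigr),$$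 i.e. $V\oplus(\mathrm{Ind}_{C_2}^{C_{2^n}}\sigma)^{\oplus 2^{n-1}m^2}\cong\rho_{\mathbb{Q}_2}^{\oplus 2^{n-1}m^2}$; and $V$ is isomorphic to the direct sum of $h^2/2^{n-1}$ copies of the regular representation $\mathbb{Q}_2[C_{2^n}/C_2]$, pulled back to $C_{2^n}$. (2) Let $\zeta$ be a generator of $C_{2^n}$, let $\omega\in\mathbb{D}_h$ be a root of unity of order $2^m-1$ that commutes with $\zeta$, and put $L=\mathbb{Q}_2(\zeta,\omega)\subset\mathbb{D}_h$. Let $(\omega_a)_{1\le a\le m}$ be a basis of $\mathbb{Q}_2(\omega)$ over $\mathbb{Q}_2$, and for each $\varphi\in\mathrm{Gal}(L/\mathbb{Q}_2)$ let $e_\varphi\in\mathbb{D}_h$ be a nonzero element with $e_\varphi x=\varphi(x)e_\varphi$ for all $x\in L$. Let $\mathcal{E}_h\subset\mathbb{D}_h$ be the subgroup generated by the elements $\zeta^j\omega_a e_\varphi$ with $0\le j<2^{n-1}$, $1\le a\le m$ and $\varphi\in\mathrm{Gal}(L/\mathbb{Q}_2)$. Then $\mathcal{E}_h$ is stable under conjugation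 by $C_{2^n}$, and as real representations of $C_{2^n}$ $$\mathbb{R}\otimes\mathcal{E}_h\;\cong\;2^{n-1}m^2\bigl(\rho_{\mathbb{R}}-\mathrm{Ind}_{C_2}^{C_{2^n}}\sigma\bigr),$$ in the same sense as in (1), and $\mathbb{R}\otimes\mathcal{E}_h$ is isomorphic to the direct sum of $h^2/2^{n-1}$ copies of the real regular representation of $C_{2^n}/C_2$, pulled back to $C_{2^n}$. -/

import Mathlib

open scoped Manifold ContDiff TensorProduct

noncomputable section

namespace Morava

/-! ### The adjoint representation of a Lie group -/

section Adjoint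

variable {𝕜 : Type*} [NontriviallyNormedField 𝕜]
  {E : Type*} [NormedAddCommGroup E] [NormedSpace 𝕜 E]
  {H : Type*} [TopologicalSpace H] (I : ModelWithCorners 𝕜 E H)
  (G : Type*) [TopologicalSpace G] [ChartedSpace H G] [Group G]

/-- Conjugation by `g`, as a self-map of the group `G`. -/
def conjMap {G : Type*} [Group G] (g : G) : G → G := fun x => g * x * g⁻¹

theorem conjMap_one {G : Type*} [Group G] (g : G) : conjMap g 1 = 1 := by simp [conjMap]

theorem mdifferentiable_conjMap [LieGroup I ω G] (g : G) :
    MDifferentiable I I (conjMap g) := by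
  have h : ContMDiff I I ω (conjMap g) :=
    (contMDiff_mul_right (a := g⁻¹)).comp (contMDiff_mul_left (a := g))
  exact h.mdifferentiable (by simp)

/-- The derivative at the identity of conjugation by `g`, as an endomorphism of the Lie algebra
(the tangent space at the identity). -/
def adjointMap (g : G) : GroupLieAlgebra I G →L[𝕜] GroupLieAlgebra I G :=
  mfderiv I I (conjMap g) 1

/-- The adjoint representation of a Lie group on its Lie algebra. -/
def adjointRep [LieGroup I ω G] : Representation 𝕜 G (GroupLieAlgebra I G) where
  toFun g := (adjointMap I G g).toLinearMap
  map_one' := by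
    have key : ∀ f : G → G, f = id → ∀ v : E, (mfderiv I I f (1 : G) v : E) = v := by
      rintro f rfl v
      rw [mfderiv_id]
      rfl
    ext v
    exact key _ (by ext x; simp [conjMap]) v
  map_mul' g g' := by
    have hd := mfderiv_comp_of_eq (x := (1 : G)) (y := 1)
      (mdifferentiable_conjMap I G g 1) (mdifferentiable_conjMap I G g' 1) (conjMap_one g')
    have key : ∀ f : G → G, f = conjMap g ∘ conjMap g' → ∀ v : E,
        (mfderiv I I f (1 : G) v : E) =
          (mfderiv I I (conjMap g) (1 : G) (mfderiv I I (conjMap g') (1 : G) v : E) : E) := by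
      rintro f rfl v
      rw [hd, conjMap_one]
      rfl
    ext v
    exact key _ (by ext x; simp [conjMap, mul_assoc]) v

end Adjoint

/-! ### The division algebra of Hasse invariant `1/h`, its maximal order and the stabilizer group -/

section Division

variable (p : ℕ) [Fact p.Prime]

/-- `D` is the central division algebra over `ℚ_[p]` of Hasse invariant `1/h`: it is central of
dimension `h ^ 2`, and it is the cyclic algebra `(K / ℚ_p, Frobenius, p)` with `K = ℚ_p(w)` the
unramified extension of degree `h`, i.e. it contains a root of unity `w` of order `p ^ h - 1` and an
element `π` with `π ^ h = p` inducing the Frobenius `w ↦ w ^ p` on `ℚ_p(w)` by conjugation. -/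
structure HasHasseInvariantOneDiv (h : ℕ) (D : Type*) [DivisionRing D] [Algebra ℚ_[p] D] :
    Prop where
  isCentral : Algebra.IsCentral ℚ_[p] D
  finrank_eq : Module.finrank ℚ_[p] D = h ^ 2
  invariant : ∃ w π : D, orderOf w = p ^ h - 1 ∧ π * w = w ^ p * π ∧ π ^ h = (p : D)

theorem isUltrametricDist (p : ℕ) [Fact p.Prime] (D : Type*) [NormedDivisionRing D]
    [NormedAlgebra ℚ_[p] D] : IsUltrametricDist D := by
  apply IsUltrametricDist.isUltrametricDist_of_forall_norm_natCast_le_one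
  intro k
  have : (k : D) = algebraMap ℚ_[p] D (k : ℚ_[p]) := by simp
  rw [this, norm_algebraMap']
  exact_mod_cast Padic.norm_int_le_one (p := p) (k : ℤ)

variable (D : Type*) [NormedDivisionRing D] [NormedAlgebra ℚ_[p] D]

/-- The maximal order of a division algebra `D` over `ℚ_[p]`: its valuation ring, the closed unit
ball for the absolute value of `D` that extends the `p`-adic one. -/
def maximalOrder : Subring D where
  carrier := {x | ‖x‖ ≤ 1}
  mul_mem' {a b} ha hb := by
    simp only [Set.mem_ofPred_eq, norm_mul] at *
    exact mul_le_one₀ ha (norm_nonneg _) hb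
  one_mem' := by simp
  add_mem' {a b} ha hb := by
    have := isUltrametricDist p D
    exact (IsUltrametricDist.norm_add_le_max a b).trans (max_le ha hb)
  zero_mem' := by simp
  neg_mem' {a} ha := by simpa using ha

/-- The (small) Morava stabilizer group `𝒪_D^×`, the group of units of the maximal order. -/
abbrev Stabilizer : Type _ := (maximalOrder p D)ˣ

/-- The inclusion `𝒪_D^× → D^×`. -/
def Stabilizer.toUnits : Stabilizer p D →* Dˣ := Units.map (maximalOrder p D).subtype.toMonoidHom

theorem isOpen_maximalOrder : IsOpen (maximalOrder p D : Set D) := by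
  have := isUltrametricDist p D
  have : (maximalOrder p D : Set D) = Metric.closedBall 0 1 := by
    ext x; simp [maximalOrder]
  rw [this]
  exact IsUltrametricDist.isOpen_closedBall _ one_ne_zero

variable [FiniteDimensional ℚ_[p] D]

theorem isOpenEmbedding_stabilizer_val :
    Topology.IsOpenEmbedding (fun u : Stabilizer p D => ((u : maximalOrder p D) : D)) := by
  have : CompleteSpace D := FiniteDimensional.complete ℚ_[p] D
  have hc : IsClosed (maximalOrder p D : Set D) := by
    have : (maximalOrder p D : Set D) = Metric.closedBall 0 1 := by
      ext x; simp [maximalOrder]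
    rw [this]
    exact Metric.isClosed_closedBall
  have : CompleteSpace (maximalOrder p D) := hc.completeSpace_coe
  exact (isOpen_maximalOrder p D).isOpenEmbedding_subtypeVal.comp Units.isOpenEmbedding_val

/-- `𝒪_D^×` is an open subset of `D`, and so is a `p`-adic manifold modelled on `D`. -/
instance : ChartedSpace D (Stabilizer p D) :=
  (isOpenEmbedding_stabilizer_val p D).singletonChartedSpace

instance : IsManifold 𝓘(ℚ_[p], D) ω (Stabilizer p D) :=
  (isOpenEmbedding_stabilizer_val p D).isManifold_singleton

theorem contMDiff_stabilizer_val :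
    ContMDiff 𝓘(ℚ_[p], D) 𝓘(ℚ_[p], D) ω
      (fun u : Stabilizer p D => ((u : maximalOrder p D) : D)) :=
  contMDiff_isOpenEmbedding (isOpenEmbedding_stabilizer_val p D)

/-- With this manifold structure `𝒪_D^×` is a `p`-adic Lie group. -/
instance : LieGroup 𝓘(ℚ_[p], D) ω (Stabilizer p D) where
  contMDiff_mul := by
    apply ContMDiff.of_comp_isOpenEmbedding (isOpenEmbedding_stabilizer_val p D)
    have h : ContMDiff (𝓘(ℚ_[p], D).prod 𝓘(ℚ_[p], D)) 𝓘(ℚ_[p], D × D) ω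
      (fun x : Stabilizer p D × Stabilizer p D =>
        (((x.1 : maximalOrder p D) : D), ((x.2 : maximalOrder p D) : D))) :=
      ((contMDiff_stabilizer_val p D).comp contMDiff_fst).prodMk_space
        ((contMDiff_stabilizer_val p D).comp contMDiff_snd)
    have h2 : ContMDiff 𝓘(ℚ_[p], D × D) 𝓘(ℚ_[p], D) ω (fun x : D × D => x.1 * x.2) := by
      rw [contMDiff_iff_contDiff]
      exact contDiff_mul
    exact h2.comp h
  contMDiff_inv := by
    have : CompleteSpace D := FiniteDimensional.complete ℚ_[p] D
    apply ContMDiff.of_comp_isOpenEmbedding (isOpenEmbedding_stabilizer_val p D)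
    have : (fun u : Stabilizer p D => ((u : maximalOrder p D) : D)) ∘ (fun x => x⁻¹)
        = Ring.inverse ∘ (fun u : Stabilizer p D => ((u : maximalOrder p D) : D)) := by
      ext u
      exact (Ring.inverse_unit (Stabilizer.toUnits p D u)).symm
    rw [this]
    intro x
    refine ContMDiffAt.comp x ?_ (contMDiff_stabilizer_val p D x)
    rw [contMDiffAt_iff_contDiffAt]
    exact contDiffAt_ringInverse ℚ_[p] (Stabilizer.toUnits p D x)

end Division

/-! ### Representations of cyclic groups -/

section Reps

variable (k : Type*) [CommRing k]

/-- The direct sum of `N` copies of a representation. -/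
def copies {k : Type*} [CommRing k] {G V : Type*} [Monoid G] [AddCommGroup V] [Module k V] (N : ℕ)
    (ρ : Representation k G V) : Representation k G (DirectSum (Fin N) fun _ => V) :=
  Representation.directSum fun _ : Fin N => ρ

variable (C : Type*) [CommGroup C]

/-- The subgroup of elements with `g ^ 2 = 1`; in a cyclic group of order `2 ^ n` with `n ≥ 1` this
is the subgroup `C_2` of order two. -/
def subgroupC₂ : Subgroup C := (powMonoidHom 2 : C →* C).ker

open Classical in
/-- The one-dimensional representation in which `g ≠ 1` acts as `-1` and `1` acts as `1`, for a
group of order two: the action on such a group by translation is through permutations, and a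
translation by `g ≠ 1` is a transposition, of sign `-1`. -/
def signRep (A : Type*) [Group A] [Finite A] : Representation k A k :=
  letI := Fintype.ofFinite A
  ((Algebra.lmul k k : k →* Module.End k k).comp
    ((Int.castRingHom k : ℤ →* k).comp (Units.coeHom ℤ))).comp
      (Equiv.Perm.sign.comp (MulAction.toPermHom A A))

theorem signRep_apply_of_ne_one (A : Type*) [Group A] [Finite A] (hA : Nat.card A = 2) (g : A)
    (hg : g ≠ 1) (x : k) : signRep k A g x = -x := by
  classical
  let _ := Fintype.ofFinite A
  have hall : ∀ a : A, a = 1 ∨ a = g := by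
    intro a
    by_contra hne
    push Not at hne
    have h3 : ({1, g, a} : Finset A).card = 3 := by
      rw [Finset.card_eq_three]
      exact ⟨1, g, a, hg.symm, hne.1.symm, hne.2.symm, rfl⟩
    have := Finset.card_le_univ ({1, g, a} : Finset A)
    rw [← Nat.card_eq_fintype_card, hA] at this
    omega
  have hgg : g * g = 1 := by
    rcases hall (g * g) with h | h
    · exact h
    · exact absurd (mul_eq_left.mp h) hg
  have hs : MulAction.toPermHom A A g = Equiv.swap 1 g := by
    ext a
    rcases hall a with h | h
    · simp [h]
    · simp [h, hgg]
  have : Equiv.Perm.sign (MulAction.toPermHom A A g) = -1 := by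
    rw [hs]; exact Equiv.Perm.sign_swap hg.symm
  simp only [signRep, MonoidHom.comp_apply]
  have h2 : ∀ i : Fintype A, ∀ j : DecidableEq A,
      @Equiv.Perm.sign A j i (MulAction.toPermHom A A g) = -1 := by
    intro i j
    rw [← this]
    congr!
  rw [h2]
  simp

/-- The representation `Ind_{C_2}^C σ` induced from the sign representation of `C_2`. -/
def indSign [Finite C] : Representation k C (Representation.IndV (subgroupC₂ C).subtype
    (signRep k (subgroupC₂ C))) :=
  Representation.ind (subgroupC₂ C).subtype (signRep k (subgroupC₂ C))

/-- The regular representation of `C / C_2`, pulled back along the quotient map `C → C / C_2`. -/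
def quotientRegularRep : Representation k C (MonoidAlgebra k (C ⧸ subgroupC₂ C)) :=
  (Representation.leftRegular k (C ⧸ subgroupC₂ C)).comp (QuotientGroup.mk' (subgroupC₂ C))

variable {k C}

/-- Extension of scalars of an integral representation to the real numbers. -/
def realification {G L : Type*} [Monoid G] [AddCommGroup L] (ρ : Representation ℤ G L) :
    Representation ℝ G (ℝ ⊗[ℤ] L) :=
  ((Module.End.baseChangeHom ℤ ℝ L : Module.End ℤ L →* Module.End ℝ (ℝ ⊗[ℤ] L))).comp ρ

end Reps

/-! ### The lattice in the division algebra -/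

section Lattice

/-- The conjugation action of the units of a ring on the ring. -/
def conjRep (D : Type*) [Ring D] : Representation ℤ Dˣ D where
  toFun u :=
    (AddMonoidHom.mk' (fun x => (u : D) * x * ((u⁻¹ : Dˣ) : D))
      (by intro x y; simp [mul_add, add_mul])).toIntLinearMap
  map_one' := by ext x; simp
  map_mul' u v := by ext x; simp [mul_assoc]

/-- The subgroup of `D` generated by the elements `ζ ^ j * b a * e φ` for `0 ≤ j < N`. -/
def latticeSpan {D : Type*} [Ring D] {A Φ : Type*} (ζ : D) (N : ℕ) (b : A → D) (e : Φ → D) :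
    Submodule ℤ D :=
  Submodule.span ℤ {x | ∃ j < N, ∃ a φ, x = ζ ^ j * b a * e φ}

end Lattice

end Morava

end

/-! Put `N = 2 ^ (n - 1)`, so `h = N * m` and `ζ ^ N = -1`. Since `-1` is central, conjugation `T`
by `ζ` satisfies `T ^ N = 1`, and the action factors through `C / C_2`. The aim is to find `N * m ^
2` vectors whose orbits under `1, T, ..., T ^ (N - 1)` are jointly independent. As `N * (N * m ^ 2)
= h ^ 2` is the full dimension, these orbits form a basis permuted freely by `C / C_2`
(`nonempty_equiv_of_linearIndependent`). The form with the induced sign representation follows by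
splitting the regular representation into its even and odd parts for `C_2`.

A local diffeomorphism of groups identifies the Lie algebra of `G` with `D` under conjugation
(`exists_linearEquiv_groupLieAlgebra`). Let `K = ℚ_2(ζ)` act on `D` from the left. Then `T` is
`K`-linear, and its eigenvalues are `N`-th roots of unity, all of them powers of `ζ ^ 2` in `K`.
Each eigenspace is non-zero, because the operators `d ↦ a * d * b` satisfy no unexpected relations
in a central division algebra. Because `T` is multiplicative, left multiplication by an eigenvector
moves the fixed space onto its eigenspace, so all have `K`-dimension `m ^ 2`. A sum of one basis
vector from each eigenspace generates a free orbit by Vandermonde, and a `ℚ_2`-basis of `K`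
multiplies these generators (`exists_linearIndependent_conj_pow`).

For the lattice the eigenvectors are explicit: `e φ` has eigenvalue `ζ * φ(ζ)⁻¹`, and each possible
value `φ(ζ)` is taken by exactly `m` automorphisms (`exists_equiv_algEquiv`). The same sums now lie
in the lattice. They span a sublattice of full rank, which suffices over `ℝ`. -/

noncomputable section

namespace Morava

/-! ### Recognizing sums of copies of the regular representation of `C / C_2`. -/

section Criterion

variable {k : Type*} [Field k] {C : Type*} [CommGroup C]

theorem card_subgroupC₂ [Finite C] [IsCyclic C] (h : 2 ∣ Nat.card C) :
    Nat.card (subgroupC₂ C) = 2 := by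
  rw [subgroupC₂, IsCyclic.card_powMonoidHom_ker, Nat.gcd_eq_right h]

theorem quotientRegularRep_single (g : C) (q : C ⧸ subgroupC₂ C) (r : k) :
    quotientRegularRep k C g (.single q r) = .single ((g : C ⧸ subgroupC₂ C) * q) r := by
  simp [quotientRegularRep]

/-- Copies of a sum of two representations. -/
theorem nonempty_copies_prod {V W U : Type*} [AddCommGroup V] [Module k V] [AddCommGroup W]
    [Module k W] [AddCommGroup U] [Module k U] {ρ : Representation k C V}
    {σ : Representation k C W} {τ : Representation k C U} (M : ℕ) (e : (ρ.prod σ).Equiv τ) :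
    Nonempty (((copies M ρ).prod (copies M σ)).Equiv (copies M τ)) := by
  let F : ((DirectSum (Fin M) fun _ => V) × (DirectSum (Fin M) fun _ => W)) →ₗ[k]
      (DirectSum (Fin M) fun _ => U) :=
    LinearMap.coprod (DirectSum.lmap fun _ => e.toLinearMap ∘ₗ LinearMap.inl k V W)
      (DirectSum.lmap fun _ => e.toLinearMap ∘ₗ LinearMap.inr k V W)
  let B : (DirectSum (Fin M) fun _ => U) →ₗ[k]
      ((DirectSum (Fin M) fun _ => V) × (DirectSum (Fin M) fun _ => W)) :=
    LinearMap.prod (DirectSum.lmap fun _ => LinearMap.fst k V W ∘ₗ e.symm.toLinearMap)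
      (DirectSum.lmap fun _ => LinearMap.snd k V W ∘ₗ e.symm.toLinearMap)
  have hF : ∀ v w i, F (v, w) i = e (v i, w i) := by
    intro v w i
    have : ((v i, w i) : V × W) = (v i, 0) + (0, w i) := by simp
    rw [this, map_add]
    rfl
  have hB1 : ∀ u i, (B u).1 i = (e.symm (u i)).1 := fun u i => rfl
  have hB2 : ∀ u i, (B u).2 i = (e.symm (u i)).2 := fun u i => rfl
  refine ⟨Representation.Equiv.mk (LinearEquiv.ofLinearMap F B ?_ ?_) ?_⟩
  · refine LinearMap.ext fun u => DFinsupp.ext fun i => ?_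
    change F ((B u).1, (B u).2) i = u i
    rw [hF, hB1, hB2]
    exact e.apply_symm_apply (u i)
  · refine LinearMap.ext fun x => Prod.ext (DFinsupp.ext fun i => ?_) (DFinsupp.ext fun i => ?_)
    · change (B (F (x.1, x.2))).1 i = x.1 i
      rw [hB1, hF, e.symm_apply_apply]
    · change (B (F (x.1, x.2))).2 i = x.2 i
      rw [hB2, hF, e.symm_apply_apply]
  · intro g
    refine LinearMap.ext fun x => DFinsupp.ext fun i => ?_
    change F (copies M ρ g x.1, copies M σ g x.2) i = τ g (F (x.1, x.2) i)
    rw [hF, hF]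
    exact LinearMap.congr_fun (e.toIntertwiningMap.isIntertwining' g) (x.1 i, x.2 i)

/-- The regular representation is the sum of the parts on which `C_2` acts trivially and by the
sign. -/
theorem nonempty_quotientRegularRep_prod_indSign [Finite C] (h2k : (2 : k) ≠ 0)
    (h2 : Nat.card (subgroupC₂ C) = 2) :
    Nonempty (((quotientRegularRep k C).prod (indSign k C)).Equiv
      (Representation.leftRegular k C)) := by
  obtain ⟨z, hz⟩ : ∃ z : subgroupC₂ C, z ≠ 1 := by
    have : Nontrivial (subgroupC₂ C) := Finite.one_lt_card_iff_nontrivial.1 (by omega)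
    exact exists_ne 1
  have hsign : ∀ x : k, signRep k (subgroupC₂ C) z x = -x :=
    signRep_apply_of_ne_one k _ h2 z hz
  have hall : ∀ s : subgroupC₂ C, s = 1 ∨ s = z := by
    intro s
    by_contra! hs
    obtain ⟨a, b, hab, hu⟩ := Nat.card_eq_two_iff.1 h2
    have hmem : ∀ t : subgroupC₂ C, t = a ∨ t = b := fun t => by
      simpa using hu.ge (Set.mem_univ t)
    rcases hmem s with h | h <;> rcases hmem z with h' | h' <;>
      rcases hmem 1 with h'' | h'' <;> simp_all
  have hz2 : (z : C) * z = 1 := by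
    have : (z : C) ^ 2 = 1 := z.2
    rwa [sq] at this
  have hzinv : (z : C)⁻¹ = z := inv_eq_of_mul_eq_one_left hz2
  -- The generators of the induced representation; the coinvariants impose `mk' (z * g) = -mk' g`.
  let mk' : C → k →ₗ[k] Representation.IndV (subgroupC₂ C).subtype (signRep k (subgroupC₂ C)) :=
    Representation.IndV.mk (subgroupC₂ C).subtype (signRep k (subgroupC₂ C))
  have hmkz : ∀ (g : C) (x : k), mk' ((z : C) * g) x = -mk' g x := by
    intro g x
    have := Representation.Coinvariants.mk_self_apply
      (Representation.tprod ((Representation.leftRegular k C).comp (subgroupC₂ C).subtype)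
        (signRep k (subgroupC₂ C))) z (MonoidAlgebra.single g 1 ⊗ₜ[k] x)
    simp only [Representation.tprod_apply, TensorProduct.map_tmul, hsign, MonoidHom.comp_apply,
      Subgroup.coe_subtype, Representation.ofMulAction_single, TensorProduct.tmul_neg, map_neg,
      smul_eq_mul] at this
    simp only [mk', Representation.IndV.mk, LinearMap.comp_apply, TensorProduct.mk_apply]
    rw [← this, neg_neg]
  -- The inverse in `mk' g⁻¹` appears because `g` acts on the induced representation by `mk' h ↦ mk'
  -- (h * g⁻¹)`.
  let F : MonoidAlgebra k C →ₗ[k] MonoidAlgebra k (C ⧸ subgroupC₂ C) ×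
      Representation.IndV (subgroupC₂ C).subtype (signRep k (subgroupC₂ C)) :=
    (MonoidAlgebra.basis C k).constr k fun g => (.single g 1, mk' g⁻¹ 1)
  have hF : ∀ g, F (.single g 1) = (.single (g : C ⧸ subgroupC₂ C) 1, mk' g⁻¹ 1) := fun g => by
    have := (MonoidAlgebra.basis C k).constr_basis k
      (fun g : C => ((.single (g : C ⧸ subgroupC₂ C) 1, mk' g⁻¹ 1) :
        MonoidAlgebra k (C ⧸ subgroupC₂ C) × _)) g
    simpa using this
  -- The inverse of `F` is symmetrization over `C_2` on the first factor and antisymmetrization on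
  -- the second; both need `2` to be invertible.
  let sym : C → MonoidAlgebra k C := fun g =>
    (2⁻¹ : k) • (MonoidAlgebra.single g 1 + MonoidAlgebra.single ((z : C) * g) 1)
  have hsym : ∀ g g' : C, (QuotientGroup.leftRel (subgroupC₂ C)) g g' → sym g = sym g' := by
    intro g g' h
    rw [QuotientGroup.leftRel_apply] at h
    obtain h1 | h1 := hall ⟨_, h⟩
    · have : g⁻¹ * g' = 1 := congrArg Subtype.val h1
      rw [inv_mul_eq_one.1 this]
    · have : g⁻¹ * g' = z := congrArg Subtype.val h1
      have h3 : g' = z * g := by rw [← this]; group; rw [mul_comm]; simp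
      simp only [sym, h3, ← mul_assoc, hz2, one_mul]
      rw [add_comm]
  let B₁ : MonoidAlgebra k (C ⧸ subgroupC₂ C) →ₗ[k] MonoidAlgebra k C :=
    (MonoidAlgebra.basis _ k).constr k fun q => Quotient.lift sym hsym q
  have hB₁ : ∀ g : C, B₁ (.single (g : C ⧸ subgroupC₂ C) 1) = sym g := fun g => by
    have := (MonoidAlgebra.basis (C ⧸ subgroupC₂ C) k).constr_basis k
      (fun q => Quotient.lift sym hsym q) (g : C ⧸ subgroupC₂ C)
    simpa using this
  let alt : MonoidAlgebra k C →ₗ[k] MonoidAlgebra k C :=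
    (MonoidAlgebra.basis C k).constr k fun g =>
      (2⁻¹ : k) • (MonoidAlgebra.single g⁻¹ 1 - MonoidAlgebra.single ((z : C) * g⁻¹) 1)
  have halt : ∀ g : C, alt (.single g 1) =
      (2⁻¹ : k) • (MonoidAlgebra.single g⁻¹ 1 - MonoidAlgebra.single ((z : C) * g⁻¹) 1) :=
    fun g => by
      have := (MonoidAlgebra.basis C k).constr_basis k (fun g : C =>
        (2⁻¹ : k) • (MonoidAlgebra.single g⁻¹ (1 : k) - MonoidAlgebra.single ((z : C) * g⁻¹) 1)) g
      simpa using this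
  -- Antisymmetrization turns translation by `z` into the sign, which is what lets it descend to the
  -- coinvariants.
  have haltz : ∀ x, alt (Representation.leftRegular k C z x) = -alt x := by
    intro x
    rw [← LinearMap.comp_apply, ← LinearMap.neg_apply]
    refine LinearMap.congr_fun ((MonoidAlgebra.basis C k).ext fun g => ?_) x
    simp only [LinearMap.comp_apply, LinearMap.neg_apply, MonoidAlgebra.basis_apply,
      Representation.ofMulAction_single, smul_eq_mul, halt, mul_inv_rev, hzinv]
    rw [mul_comm g⁻¹ (z : C), ← mul_assoc, hz2, one_mul]
    module
  let B₂ : Representation.IndV (subgroupC₂ C).subtype (signRep k (subgroupC₂ C)) →ₗ[k]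
      MonoidAlgebra k C :=
    Representation.Coinvariants.lift _ (TensorProduct.lift ((LinearMap.lsmul k _).flip ∘ₗ alt)) (by
      intro s
      rcases hall s with h | h
      · rw [h, map_one]
        rfl
      · refine TensorProduct.ext' fun x y => ?_
        simp [h, hsign, haltz])
  have hB₂ : ∀ g : C, B₂ (mk' g 1) =
      (2⁻¹ : k) • (MonoidAlgebra.single g⁻¹ 1 - MonoidAlgebra.single ((z : C) * g⁻¹) 1) := by
    intro g
    simp only [B₂, mk', Representation.IndV.mk, LinearMap.comp_apply, TensorProduct.mk_apply,
      Representation.Coinvariants.lift_mk, TensorProduct.lift.tmul, LinearMap.flip_apply,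
      LinearMap.lsmul_apply, halt, one_smul]
  refine ⟨(Representation.Equiv.mk (LinearEquiv.ofLinearMap F (LinearMap.coprod B₁ B₂)
    ?_ ?_) fun g => ?_).symm⟩
  · refine LinearMap.prod_ext ?_ ?_
    · refine (MonoidAlgebra.basis _ k).ext fun q => ?_
      obtain ⟨g, rfl⟩ := QuotientGroup.mk_surjective q
      have hq : ((z * g : C) : C ⧸ subgroupC₂ C) = g := by
        rw [mul_comm, QuotientGroup.eq]; simp
      simp only [LinearMap.comp_apply, LinearMap.inl_apply, LinearMap.coprod_apply, map_zero,
        add_zero, MonoidAlgebra.basis_apply, hB₁, sym, map_smul, map_add, hF, hq, mul_inv_rev,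
        hzinv, LinearMap.id_apply]
      rw [mul_comm _ (z : C), hmkz]
      refine Prod.ext ?_ ?_
      · simp only [Prod.smul_fst, Prod.fst_add, ← two_smul k, smul_smul, inv_mul_cancel₀ h2k,
          one_smul]
      · simp
    · refine Representation.IndV.hom_ext _ _ fun g => LinearMap.ext_ring ?_
      have hq : ((z * g⁻¹ : C) : C ⧸ subgroupC₂ C) = ((g⁻¹ : C) : C ⧸ subgroupC₂ C) := by
        rw [mul_comm, QuotientGroup.eq]; simp
      change F (LinearMap.coprod B₁ B₂ (0, mk' g 1)) = (0, mk' g 1)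
      simp only [LinearMap.coprod_apply, map_zero, zero_add, hB₂, map_smul, map_sub, hF, hq,
        mul_inv_rev, hzinv, inv_inv]
      rw [mul_comm _ (z : C), hmkz]
      refine Prod.ext ?_ ?_
      · simp
      · simp only [Prod.smul_snd, Prod.snd_sub, sub_neg_eq_add, ← two_smul k, smul_smul,
          inv_mul_cancel₀ h2k, one_smul]
  · refine (MonoidAlgebra.basis C k).ext fun g => ?_
    simp only [LinearMap.comp_apply, MonoidAlgebra.basis_apply, hF, LinearMap.coprod_apply, hB₁,
      hB₂, sym, inv_inv, LinearMap.id_apply, ← smul_add, add_add_sub_cancel]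
    rw [← two_smul k, smul_smul, inv_mul_cancel₀ h2k, one_smul]
  · refine (MonoidAlgebra.basis C k).ext fun g' => ?_
    rw [LinearMap.comp_apply, LinearMap.comp_apply, MonoidAlgebra.basis_apply]
    have h1 : F (Representation.leftRegular k C g (.single g' 1)) =
        ((quotientRegularRep k C).prod (indSign k C)) g (F (.single g' 1)) := by
      rw [Representation.ofMulAction_single, smul_eq_mul, hF, hF]
      refine Prod.ext (quotientRegularRep_single g (g' : C ⧸ subgroupC₂ C) (1 : k)).symm ?_
      refine Eq.trans ?_ (Representation.ind_mk _ (signRep k (subgroupC₂ C)) g g'⁻¹ 1).symm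
      simp only [mk', mul_inv_rev]
    exact h1

/-- A representation of `C` with a basis that is permuted by `C` like copies of `C / C_2`. -/
theorem nonempty_equiv_copies_quotientRegularRep {V : Type*} [AddCommGroup V] [Module k V]
    (ρ : Representation k C V) (M : ℕ) (Y : Module.Basis (Σ _ : Fin M, C ⧸ subgroupC₂ C) k V)
    (hY : ∀ (g : C) t q, ρ g (Y ⟨t, q⟩) = Y ⟨t, (g : C ⧸ subgroupC₂ C) * q⟩) :
    Nonempty (ρ.Equiv (copies M (quotientRegularRep k C))) := by
  let B : Module.Basis (Σ _ : Fin M, C ⧸ subgroupC₂ C) k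
      (DirectSum (Fin M) fun _ => MonoidAlgebra k (C ⧸ subgroupC₂ C)) :=
    DFinsupp.basis fun _ => MonoidAlgebra.basis _ k
  have hB : ∀ t q, B ⟨t, q⟩ = DirectSum.lof k (Fin M) _ t (.single q 1) := by
    intro t q
    rw [Module.Basis.apply_eq_iff]
    change (sigmaFinsuppLequivDFinsupp k).symm (DFinsupp.mapRange.linearEquiv
      (fun _ => (MonoidAlgebra.basis (C ⧸ subgroupC₂ C) k).repr) (DFinsupp.single t _)) = _
    rw [LinearEquiv.symm_apply_eq]
    refine (DFinsupp.mapRange_single (hf := fun _ => map_zero _)).trans ?_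
    refine Eq.trans ?_ (sigmaFinsuppEquivDFinsupp_single _ _).symm
    rw [← MonoidAlgebra.basis_apply, Module.Basis.repr_self]
  refine ⟨Representation.Equiv.mk (Y.equiv B (Equiv.refl _)) fun g => Y.ext ?_⟩
  rintro ⟨t, q⟩
  simp only [LinearMap.comp_apply, LinearEquiv.coe_coe, hY, Module.Basis.equiv_apply,
    Equiv.refl_apply, hB]
  simp [copies, quotientRegularRep_single]

/-- By dimension the `M * N` orbit vectors are a basis. As `γ ^ N` acts trivially, `ρ` factors
through `C / C_2`, whose elements are the classes of `γ ^ i` with `i < N`; so the basis consists of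
`M` free orbits of `C / C_2`. -/
theorem nonempty_equiv_of_linearIndependent [Finite C] {V : Type*} [AddCommGroup V] [Module k V]
    (ρ : Representation k C V) (M N : ℕ) (hN : 0 < N) (hM : 0 < M) (hC : Nat.card C = 2 * N)
    (h2 : Nat.card (subgroupC₂ C) = 2) (γ : C) (hγ : ∀ g : C, g ∈ Subgroup.zpowers γ)
    (hρ : ρ (γ ^ N) = 1) (y : Fin M → V)
    (hy : LinearIndependent k fun p : Fin M × Fin N => ρ (γ ^ (p.2 : ℕ)) (y p.1))
    (hV : Module.finrank k V = M * N) :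
    Nonempty (ρ.Equiv (copies M (quotientRegularRep k C))) := by
  have hord : orderOf γ = 2 * N := by rw [orderOf_eq_card_of_forall_mem_zpowers hγ, hC]
  have htriv : ∀ s ∈ subgroupC₂ C, ρ s = 1 := by
    intro s hs
    have : Fact (0 < 2 * N) := ⟨by omega⟩
    obtain ⟨i, rfl⟩ := (mem_powers_iff_mem_zpowers (x := γ)).2 (hγ s)
    have h1 : (γ ^ i) ^ 2 = 1 := hs
    rw [← pow_mul] at h1
    have h3 := orderOf_dvd_of_pow_eq_one h1
    rw [hord, mul_comm i] at h3
    obtain ⟨c, rfl⟩ := Nat.dvd_of_mul_dvd_mul_left two_pos h3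
    simp only [pow_mul γ N c, map_pow, hρ, one_pow]
  have hρq : ∀ g g' : C, (g : C ⧸ subgroupC₂ C) = g' → ρ g = ρ g' := by
    intro g g' h
    rw [QuotientGroup.eq] at h
    have h' := htriv _ h
    calc ρ g = ρ g * ρ (g⁻¹ * g') := by rw [h', mul_one]
      _ = ρ g' := by rw [← map_mul]; simp
  let E : Fin N → C ⧸ subgroupC₂ C := fun i => ((γ ^ (i : ℕ) : C) : C ⧸ subgroupC₂ C)
  have hEinj : Function.Injective E := by
    have key : ∀ i j : Fin N, (i : ℕ) ≤ j → E i = E j → i = j := by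
      intro i j hij h
      have h1 : ((γ ^ (i : ℕ))⁻¹ * γ ^ (j : ℕ)) ^ 2 = 1 := QuotientGroup.eq.1 h
      have h4 : (γ ^ (i : ℕ))⁻¹ * γ ^ (j : ℕ) = γ ^ ((j : ℕ) - i) := by
        rw [pow_sub _ hij, mul_comm]
      rw [h4, ← pow_mul] at h1
      have h3 := orderOf_dvd_of_pow_eq_one h1
      rw [hord, mul_comm _ 2] at h3
      have h5 := Nat.dvd_of_mul_dvd_mul_left two_pos h3
      have h6 := Nat.eq_zero_of_dvd_of_lt h5 (by omega)
      exact Fin.ext (by omega)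
    intro i j h
    rcases le_total (i : ℕ) j with hij | hij
    · exact key i j hij h
    · exact (key j i hij h.symm).symm
  have hcard : Nat.card (C ⧸ subgroupC₂ C) = N := by
    have := Subgroup.card_eq_card_quotient_mul_card_subgroup (subgroupC₂ C)
    rw [hC, h2] at this
    omega
  have hEbij : Function.Bijective E := by
    have : Fintype (C ⧸ subgroupC₂ C) := Fintype.ofFinite _
    rw [Fintype.bijective_iff_injective_and_card]
    exact ⟨hEinj, by rw [Fintype.card_fin, ← Nat.card_eq_fintype_card, hcard]⟩
  let e : Fin M × Fin N ≃ Σ _ : Fin M, C ⧸ subgroupC₂ C :=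
    (Equiv.prodCongr (Equiv.refl _) (Equiv.ofBijective E hEbij)).trans
      (Equiv.sigmaEquivProd _ _).symm
  have hind : LinearIndependent k
      (fun p : Σ _ : Fin M, C ⧸ subgroupC₂ C => ρ p.2.out (y p.1)) := by
    rw [← linearIndependent_equiv e]
    convert hy using 1
    ext p
    exact congrArg (fun f => f (y p.1)) (hρq _ _ (Quotient.out_eq' _))
  have : Fintype (C ⧸ subgroupC₂ C) := Fintype.ofFinite _
  have : Nonempty (Σ _ : Fin M, C ⧸ subgroupC₂ C) := ⟨⟨⟨0, hM⟩, 1⟩⟩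
  let Y := basisOfLinearIndependentOfCardEqFinrank hind (by
    rw [← Fintype.card_congr e, hV]; simp)
  refine nonempty_equiv_copies_quotientRegularRep ρ M Y fun g t q => ?_
  simp only [Y, coe_basisOfLinearIndependentOfCardEqFinrank]
  rw [← Module.End.mul_apply, ← map_mul]
  refine congrArg (fun f => f (y t)) (hρq _ _ ?_)
  rw [QuotientGroup.mk_mul, QuotientGroup.out_eq', QuotientGroup.out_eq']

end Criterion

/-! ### Vandermonde independence and two-sided multiplications in a division algebra. -/

section LinearAlgebra

/-- Vandermonde: if an endomorphism `T` has linearly independent eigenvectors `b (i, s)` for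
distinct eigenvalues `μ i`, then the powers of `T` applied to the vectors `∑ i, b (i, s)` are
linearly independent. -/
theorem linearIndependent_pow_apply_sum {K V S : Type*} [Field K] [AddCommGroup V] [Module K V]
    [Fintype S] {N : ℕ} (T : Module.End K V) (μ : Fin N → K) (hμ : Function.Injective μ)
    (b : Fin N × S → V) (hb : LinearIndependent K b) (hT : ∀ i s, T (b (i, s)) = μ i • b (i, s)) :
    LinearIndependent K fun p : S × Fin N => (T ^ (p.2 : ℕ)) (∑ i, b (i, p.1)) := by
  have hpow : ∀ (k : ℕ) i s, (T ^ k) (b (i, s)) = μ i ^ k • b (i, s) := by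
    intro k i s
    induction k with
    | zero => simp
    | succ k ih => rw [pow_succ', Module.End.mul_apply, ih, map_smul, hT, smul_smul, ← pow_succ]
  rw [Fintype.linearIndependent_iff] at hb ⊢
  intro c hc
  -- The coefficient of `b (i, s)` in the relation is the polynomial with coefficients `c (s, ·)`
  -- evaluated at `μ i`.
  have hzero := hb (fun q => ∑ k : Fin N, c (q.2, k) * μ q.1 ^ (k : ℕ)) (by
    rw [← hc, Fintype.sum_prod_type, Fintype.sum_prod_type, Finset.sum_comm]
    refine Finset.sum_congr rfl fun s _ => ?_
    simp only [map_sum, hpow, Finset.smul_sum, Finset.sum_smul, smul_smul]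
    rw [Finset.sum_comm])
  rintro ⟨s, k⟩
  exact congrFun (Matrix.eq_zero_of_forall_index_sum_mul_pow_eq_zero (v := fun k => c (s, k)) hμ
    fun i => hzero (i, s)) k

/-- In a central division algebra, the maps `d ↦ a * d * b i` for linearly independent `b i` are
left linearly independent. -/
theorem eq_zero_of_forall_sum_mul_mul_eq_zero {F D ι : Type*} [Field F] [DivisionRing D]
    [Algebra F D] [Algebra.IsCentral F D] (b : ι → D) (hb : LinearIndependent F b) (s : Finset ι) :
    ∀ a : ι → D, (∀ d, ∑ i ∈ s, a i * d * b i = 0) → ∀ i ∈ s, a i = 0 := by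
  classical
  induction s using Finset.induction_on with
  | empty => simp
  | insert i₀ s hi₀ ih =>
    intro a ha
    by_cases h0 : a i₀ = 0
    · have := ih a fun d => by simpa [Finset.sum_insert hi₀, h0] using ha d
      simpa [h0] using this
    · exfalso
      set a' : ι → D := fun i => (a i₀)⁻¹ * a i with ha'
      have ha'0 : a' i₀ = 1 := inv_mul_cancel₀ h0
      have hsum : ∀ d, d * b i₀ + ∑ i ∈ s, a' i * d * b i = 0 := by
        intro d
        have := congrArg (fun x => (a i₀)⁻¹ * x) (ha d)
        simp only [Finset.sum_insert hi₀, mul_add, mul_zero, Finset.mul_sum, ← mul_assoc,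
          inv_mul_cancel₀ h0, one_mul] at this
        exact this
      -- After normalizing `a' i₀ = 1`, the relation at `c * d` minus `c` times the relation at `d`
      -- has no `i₀` term, so the induction hypothesis makes every `a' i` central. At `d = 1` this
      -- yields a forbidden `F`-relation among the `b i`.
      have hcomm : ∀ i ∈ s, ∀ c, a' i * c - c * a' i = 0 := by
        intro i hi c
        refine ih (fun i => a' i * c - c * a' i) (fun d => ?_) i hi
        have h1 := hsum (c * d)
        have h2 := congrArg (fun x => c * x) (hsum d)
        simp only [mul_add, Finset.mul_sum, mul_zero] at h2
        have h3 : ∑ i ∈ s, (a' i * c - c * a' i) * d * b i =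
            ∑ i ∈ s, a' i * (c * d) * b i - ∑ i ∈ s, c * (a' i * d * b i) := by
          rw [← Finset.sum_sub_distrib]
          exact Finset.sum_congr rfl fun i _ => by noncomm_ring
        rw [h3, eq_neg_of_add_eq_zero_right h1, eq_neg_of_add_eq_zero_right h2]
        noncomm_ring
      have hcen : ∀ i ∈ s, ∃ r : F, algebraMap F D r = a' i := by
        intro i hi
        have : a' i ∈ Subalgebra.center F D :=
          Subalgebra.mem_center_iff.2 fun c => (sub_eq_zero.1 (hcomm i hi c)).symm
        rw [Algebra.IsCentral.center_eq_bot] at this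
        exact Algebra.mem_bot.1 this
      choose! r hr using hcen
      have h1 := hsum 1
      have h2 := linearIndependent_iff'.1 hb (insert i₀ s)
        (fun i => if i = i₀ then 1 else r i) (by
          rw [Finset.sum_insert hi₀, ← h1]
          simp only [if_true, one_smul, one_mul, mul_one]
          congr 1
          refine Finset.sum_congr rfl fun i hi => ?_
          simp only [if_neg (show i ≠ i₀ from fun h => hi₀ (h ▸ hi)), Algebra.smul_def, hr i hi]) i₀
          (Finset.mem_insert_self _ _)
      simp at h2

end LinearAlgebra

/-! ### Irreducibility of the cyclotomic polynomial of 2-power order over `ℚ_2`. -/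

section Cyclotomic

open Polynomial

/-- After the shift `X ↦ X + 1` the polynomial is Eisenstein at `2`: the middle binomial
coefficients are even and the constant term is `1 + 1 = 2`. -/
theorem irreducible_X_pow_add_one_padic (n : ℕ) :
    Irreducible (X ^ 2 ^ n + 1 : ℚ_[2][X]) := by
  have hp : Prime (2 : ℤ_[2]) := by exact_mod_cast PadicInt.prime_p (p := 2)
  set f : ℤ_[2][X] := (X + C 1) ^ 2 ^ n + C 1 with hf
  have hpow : (0 : ℕ) < 2 ^ n := by positivity
  have hdeg : natDegree ((X + C 1 : ℤ_[2][X]) ^ 2 ^ n) = 2 ^ n := by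
    rw [natDegree_pow, natDegree_X_add_C, mul_one]
  have hmon : f.Monic := ((monic_X_add_C 1).pow _).add_of_left (by
    rw [degree_C one_ne_zero, ← natDegree_pos_iff_degree_pos, hdeg]
    exact hpow)
  have hfdeg : f.natDegree = 2 ^ n := by rw [hf, natDegree_add_C, hdeg]
  have hcoeff : ∀ i, ((X + C 1 : ℤ_[2][X]) ^ 2 ^ n).coeff i = ((2 ^ n).choose i : ℤ_[2]) := by
    intro i
    rw [C_1, coeff_X_add_one_pow]
  have heis : f.IsEisensteinAt (Ideal.span {(2 : ℤ_[2])}) := by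
    refine hmon.isEisensteinAt_of_mem_of_notMem ?_ (fun {i} hi => ?_) ?_
    · rw [Ne, Ideal.span_singleton_eq_top]
      exact hp.not_isUnit
    · rw [hfdeg] at hi
      rw [Ideal.mem_span_singleton, hf, coeff_add, hcoeff, coeff_C]
      split_ifs with h0
      · subst h0
        norm_num
      · rw [add_zero]
        exact_mod_cast Nat.cast_dvd_cast (α := ℤ_[2])
          (Nat.prime_two.dvd_choose_pow h0 hi.ne)
    · rw [Ideal.span_singleton_pow, Ideal.mem_span_singleton, hf, coeff_add, hcoeff, coeff_C_zero,
        Nat.choose_zero_right, Nat.cast_one, one_add_one_eq_two]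
      rintro ⟨c, hc⟩
      refine hp.not_isUnit (IsUnit.of_mul_eq_one c (mul_left_cancel₀ hp.ne_zero ?_))
      rw [mul_one, ← mul_assoc, ← sq]
      exact hc.symm
  have hirr : Irreducible f := heis.irreducible
    ((Ideal.span_singleton_prime hp.ne_zero).2 hp) hmon.isPrimitive (by rw [hfdeg]; exact hpow)
  rw [hmon.irreducible_iff_irreducible_map_fraction_map (K := ℚ_[2])] at hirr
  have hmap : f.map (algebraMap ℤ_[2] ℚ_[2]) =
      algEquivAevalXAddC (1 : ℚ_[2]) (X ^ 2 ^ n + 1) := by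
    simp [hf, algEquivAevalXAddC_apply]
  rwa [hmap, MulEquiv.irreducible_iff] at hirr

end Cyclotomic

/-! ### Eigenspaces of an endomorphism of finite order. -/

section LinearAlgebra

/-- Descends free orbits from `K` to `F`: since `T` is `K`-linear, scalars `x` pull out of `T ^ k`,
and the products of two independent families in a tower are independent. -/
theorem linearIndependent_pow_apply_smul {F K V S ι : Type*} [Field F] [Field K] [Algebra F K]
    [AddCommGroup V] [Module F V] [Module K V] [IsScalarTower F K V] {N : ℕ} (T : Module.End K V)
    (v : S → V) (hv : LinearIndependent K fun p : S × Fin N => (T ^ (p.2 : ℕ)) (v p.1))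
    (x : ι → K) (hx : LinearIndependent F x) :
    LinearIndependent F fun p : (ι × S) × Fin N => (T ^ (p.2 : ℕ)) (x p.1.1 • v p.1.2) := by
  rw [← linearIndependent_equiv (Equiv.prodAssoc ι S (Fin N)).symm]
  convert linearIndependent_smul hx hv using 1
  ext p
  simp

/-- The twisted sum is `N` times the projection to an eigenspace. Orthogonality of characters makes
the sum of these over all `j` equal to `N • v`, so the eigenspaces span. -/
theorem iSup_eigenspace_of_pow_eq_one {K V : Type*} [Field K] [AddCommGroup V] [Module K V]
    {N : ℕ} (hN : (N : K) ≠ 0) (T : Module.End K V) (hT : T ^ N = 1) {η : K}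
    (hη : IsPrimitiveRoot η N) :
    (∀ j v, ∑ k ∈ Finset.range N, η ^ (j * k) • (T ^ k) v ∈ T.eigenspace (η ^ j)⁻¹) ∧
      ⨆ j : Fin N, T.eigenspace (η ^ (j : ℕ))⁻¹ = ⊤ := by
  have hN0 : N ≠ 0 := by
    rintro rfl
    simp at hN
  have hη0 : η ≠ 0 := hη.ne_zero hN0
  have hmem : ∀ j v, ∑ k ∈ Finset.range N, η ^ (j * k) • (T ^ k) v ∈
      T.eigenspace (η ^ j)⁻¹ := by
    intro j v
    rw [Module.End.mem_eigenspace_iff]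
    -- The sum of `N + 1` terms is split off at both ends; the two end terms agree because `T ^ N =
    -- 1` and `η ^ N = 1`, so shifting the index does not change the sum.
    have h1 := Finset.sum_range_succ (fun k => η ^ (j * k) • (T ^ k) v) N
    rw [Finset.sum_range_succ'] at h1
    have h2 : η ^ (j * N) • (T ^ N) v = η ^ (j * 0) • (T ^ 0) v := by
      rw [mul_comm, pow_mul, hη.pow_eq_one, hT]
      simp
    rw [h2] at h1
    refine Eq.trans ?_ (congrArg (fun x => (η ^ j)⁻¹ • x) (add_right_cancel h1))
    rw [Finset.smul_sum, map_sum]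
    refine Finset.sum_congr rfl fun k _ => ?_
    rw [map_smul, smul_smul, mul_add, pow_add, mul_one, mul_comm (η ^ (j * k)), ← mul_assoc,
      inv_mul_cancel₀ (pow_ne_zero _ hη0), one_mul, pow_succ' T, Module.End.mul_apply]
  refine ⟨hmem, ?_⟩
  rw [eq_top_iff]
  intro v _
  have hsum : ∑ j : Fin N, ∑ k ∈ Finset.range N, η ^ ((j : ℕ) * k) • (T ^ k) v = (N : K) • v := by
    rw [Finset.sum_comm]
    rw [Finset.sum_eq_single_of_mem 0 (Finset.mem_range.2 (Nat.pos_of_ne_zero hN0))]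
    · simp [← Nat.cast_smul_eq_nsmul K]
    · intro k hk hk0
      rw [← Finset.sum_smul]
      have hne : η ^ k ≠ 1 := fun h => hk0 (Nat.eq_zero_of_dvd_of_lt
        (hη.dvd_of_pow_eq_one _ h) (Finset.mem_range.1 hk))
      have hg := mul_neg_geom_sum (η ^ k) N
      rw [← pow_mul, mul_comm k N, pow_mul η N, hη.pow_eq_one, one_pow, sub_self, mul_eq_zero] at hg
      have h0 := hg.resolve_left (sub_ne_zero.2 hne.symm)
      rw [← Fin.sum_univ_eq_sum_range] at h0
      simp only [mul_comm _ k, pow_mul, h0, zero_smul]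
  have hv : v = (N : K)⁻¹ • ∑ j : Fin N, ∑ k ∈ Finset.range N, η ^ ((j : ℕ) * k) • (T ^ k) v := by
    rw [hsum, smul_smul, inv_mul_cancel₀ hN, one_smul]
  rw [hv]
  exact Submodule.smul_mem _ _ (Submodule.sum_mem _ fun j _ =>
    Submodule.mem_iSup_of_mem j (hmem j v))

theorem finrank_eq_of_iSup_eigenspace_eq_top {K V : Type*} [Field K] [AddCommGroup V] [Module K V]
    [FiniteDimensional K V] {N : ℕ} (T : Module.End K V) (μ : Fin N → K)
    (hμ : Function.Injective μ) (htop : ⨆ j, T.eigenspace (μ j) = ⊤) {r : ℕ}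
    (hr : ∀ j, Module.finrank K (T.eigenspace (μ j)) = r) : Module.finrank K V = N * r := by
  have hint : DirectSum.IsInternal fun j : Fin N => T.eigenspace (μ j) :=
    DirectSum.isInternal_submodule_of_iSupIndep_of_iSup_eq_top
      (T.eigenspaces_iSupIndep.comp hμ) htop
  rw [Module.finrank_eq_card_basis
    (hint.collectedBasis fun j => Module.finBasis K (T.eigenspace (μ j))), Fintype.card_sigma]
  simp [hr]

theorem exists_linearIndependent_eigenvectors {K V : Type*} [Field K] [AddCommGroup V] [Module K V]
    [FiniteDimensional K V] {N : ℕ} (T : Module.End K V) (μ : Fin N → K)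
    (hμ : Function.Injective μ) (htop : ⨆ j, T.eigenspace (μ j) = ⊤) {r : ℕ}
    (hr : ∀ j, Module.finrank K (T.eigenspace (μ j)) = r) :
    ∃ b : Fin N × Fin r → V, LinearIndependent K b ∧ ∀ j s, T (b (j, s)) = μ j • b (j, s) := by
  let B := fun j => Module.finBasisOfFinrankEq K (T.eigenspace (μ j)) (hr j)
  have hint : DirectSum.IsInternal fun j : Fin N => T.eigenspace (μ j) :=
    DirectSum.isInternal_submodule_of_iSupIndep_of_iSup_eq_top
      (T.eigenspaces_iSupIndep.comp hμ) htop
  refine ⟨fun p => B p.1 p.2, ?_, fun j s => Module.End.mem_eigenspace_iff.1 (B j s).2⟩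
  refine (linearIndependent_equiv (Equiv.sigmaEquivProd (Fin N) (Fin r))).1 ?_
  have hB := (hint.collectedBasis B).linearIndependent
  rw [hint.collectedBasis_coe] at hB
  exact hB

end LinearAlgebra

/-! ### Conjugation by an element of a subfield, as a linear endomorphism of the division algebra.
-/

section Conj

variable {F K D : Type*} [Field F] [Field K] [Algebra F K] [DivisionRing D] [Algebra F D]
  [Module K D] (i : K →ₐ[F] D) (hi : ∀ (x : K) (d : D), x • d = i x * d)

/-- Conjugation by an element of a commutative subfield, linear over that subfield acting from the
left. -/
def conjEnd (z : K) : Module.End K D where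
  toFun d := i z * d * (i z)⁻¹
  map_add' x y := by simp [mul_add, add_mul]
  map_smul' x d := by
    simp only [hi, RingHom.id_apply, ← mul_assoc]
    rw [← map_mul, mul_comm, map_mul]

theorem conjEnd_apply (z : K) (d : D) : conjEnd i hi z d = i z * d * (i z)⁻¹ := rfl

theorem conjEnd_pow_apply (z : K) (k : ℕ) (d : D) :
    (conjEnd i hi z ^ k) d = i z ^ k * d * (i z ^ k)⁻¹ := by
  induction k with
  | zero => simp
  | succ k ih =>
    rw [pow_succ', Module.End.mul_apply, ih, conjEnd_apply, pow_succ', mul_inv_rev]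
    simp only [← mul_assoc]

/-- The eigenprojection has the form `d ↦ ∑ a_k * d * b_k` with `b_k = z ^ (-k)` independent over
`F` and every `a_k` non-zero, so it cannot vanish identically. -/
theorem not_forall_sum_smul_conjEnd_pow_eq_zero [Algebra.IsCentral F D] (z : K) (hz0 : z ≠ 0)
    {N : ℕ} (hN : 0 < N) (hlin : LinearIndependent F fun k : Fin N => z ^ (k : ℕ)) (j : ℕ) :
    ¬ ∀ d, ∑ k ∈ Finset.range N, (z ^ 2) ^ (j * k) • (conjEnd i hi z ^ k) d = 0 := by
  intro hzero
  have hiz0 : i z ≠ 0 := (map_ne_zero i).2 hz0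
  -- Inverse powers are the powers `z ^ (N - 1 - k)` up to the common factor `z ^ (-(N - 1))`, so
  -- reversal and rescaling give their independence.
  have hlin' : LinearIndependent F fun k : Fin N => (i z ^ (k : ℕ))⁻¹ := by
    have h1 : LinearIndependent F fun k : Fin N => i (z ^ (N - 1 - (k : ℕ))) := by
      have := (hlin.map' i.toLinearMap (LinearMap.ker_eq_bot.2 i.injective)).comp Fin.rev
        Fin.rev_injective
      have hfun : (fun k : Fin N => i (z ^ (N - 1 - (k : ℕ)))) =
          (i.toLinearMap ∘ fun k : Fin N => z ^ (k : ℕ)) ∘ Fin.rev := by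
        ext k
        simp [Fin.val_rev, Nat.sub_sub, add_comm]
      rw [hfun]
      exact this
    have hu : LinearMap.ker (LinearMap.mulLeft F ((i z ^ (N - 1))⁻¹)) = ⊥ :=
      LinearMap.ker_eq_bot.2 fun a b h =>
        mul_left_cancel₀ (inv_ne_zero (pow_ne_zero _ hiz0)) h
    suffices hfun : (fun k : Fin N => (i z ^ (k : ℕ))⁻¹) =
        LinearMap.mulLeft F ((i z ^ (N - 1))⁻¹) ∘ fun k : Fin N => i (z ^ (N - 1 - (k : ℕ))) by
      rw [hfun]
      exact h1.map' _ hu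
    ext k
    have : i z ^ (N - 1) = i z ^ (N - 1 - (k : ℕ)) * i z ^ (k : ℕ) := by
      rw [← pow_add]
      congr 1
      omega
    simp only [Function.comp_apply, LinearMap.mulLeft_apply, map_pow]
    rw [this, mul_inv_rev, mul_assoc, inv_mul_cancel₀ (pow_ne_zero _ hiz0), mul_one]
  have h2 := eq_zero_of_forall_sum_mul_mul_eq_zero (F := F) _ hlin' Finset.univ
    (fun k => i ((z ^ 2) ^ (j * k)) * i z ^ (k : ℕ)) (fun d => by
      rw [← hzero d, ← Fin.sum_univ_eq_sum_range fun k => (z ^ 2) ^ (j * k) • (conjEnd i hi z ^ k) d]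
      refine Finset.sum_congr rfl fun k _ => ?_
      rw [conjEnd_pow_apply, hi]
      simp only [mul_assoc]) ⟨0, hN⟩ (Finset.mem_univ _)
  simp at h2

include hi in
-- Equal eigenspace dimensions allow the eigenbases to be indexed by `Fin N × Fin (m ^ 2)`. Each sum
-- across the eigenvalues generates a free orbit over `K`, and the `F`-basis of powers of `z` makes
-- `N` generators over `F` out of each.
theorem exists_linearIndependent_conj_pow [CharZero F] [Algebra.IsCentral F D]
    [IsScalarTower F K D] [FiniteDimensional F D] (z : K) {N m : ℕ} (hN : 0 < N)
    (hz : z ^ N = -1) (hprim : IsPrimitiveRoot (z ^ 2) N) (hK : Module.finrank F K = N)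
    (hlin : LinearIndependent F fun k : Fin N => z ^ (k : ℕ))
    (hD : Module.finrank F D = (N * m) ^ 2) :
    ∃ y : Fin (N * m ^ 2) → D, LinearIndependent F fun p : Fin (N * m ^ 2) × Fin N =>
      i z ^ (p.2 : ℕ) * y p.1 * (i z ^ (p.2 : ℕ))⁻¹ := by
  classical
  have hz0 : z ≠ 0 := by
    rintro rfl
    rw [zero_pow hN.ne'] at hz
    simp at hz
  have hη0 : z ^ 2 ≠ 0 := pow_ne_zero _ hz0
  have hiz0 : i z ≠ 0 := (map_ne_zero i).2 hz0
  have : CharZero K := charZero_of_injective_algebraMap (algebraMap F K).injective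
  have : FiniteDimensional F K := Module.finite_of_finrank_pos (by omega)
  have hNK : (N : K) ≠ 0 := Nat.cast_ne_zero.2 hN.ne'
  set T := conjEnd i hi z with hTdef
  have hT : T ^ N = 1 := by
    ext d
    rw [conjEnd_pow_apply, ← map_pow, hz]
    simp
  obtain ⟨hmem, htop⟩ := iSup_eigenspace_of_pow_eq_one hNK T hT hprim
  set μ : Fin N → K := fun j => ((z ^ 2) ^ (j : ℕ))⁻¹ with hμdef
  have hμ : Function.Injective μ := fun j j' h =>
    Fin.ext (hprim.pow_inj j.2 j'.2 (inv_injective h))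
  -- every eigenspace is non-zero
  have hex : ∀ j : Fin N, ∃ e : D, e ≠ 0 ∧ T e = μ j • e := by
    intro j
    by_contra! hne
    have hzero : ∀ d, ∑ k ∈ Finset.range N, (z ^ 2) ^ ((j : ℕ) * k) • (T ^ k) d = 0 := by
      intro d
      by_contra h0
      exact hne _ h0 (Module.End.mem_eigenspace_iff.1 (hmem j d))
    exact not_forall_sum_smul_conjEnd_pow_eq_zero i hi z hz0 hN hlin j hzero
  choose e he0 he using hex
  have hmulT : ∀ x y, T (x * y) = T x * T y := by
    intro x y
    simp only [hTdef, conjEnd_apply, mul_assoc]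
    rw [inv_mul_cancel_left₀ hiz0]
  -- all eigenspaces have the same dimension
  have hequiv : ∀ j, Nonempty (T.eigenspace 1 ≃ₗ[F] T.eigenspace (μ j)) := by
    intro j
    have h1 : ∀ x ∈ T.eigenspace 1, e j * x ∈ T.eigenspace (μ j) := by
      intro x hx
      rw [Module.End.mem_eigenspace_iff, one_smul] at hx
      rw [Module.End.mem_eigenspace_iff, hmulT, he, hx, hi, hi, mul_assoc]
    have h2 : ∀ x ∈ T.eigenspace (μ j), (e j)⁻¹ * x ∈ T.eigenspace 1 := by
      intro x hx
      rw [Module.End.mem_eigenspace_iff] at hx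
      have h3 : T ((e j) * ((e j)⁻¹ * x)) = μ j • x := by rw [mul_inv_cancel_left₀ (he0 j), hx]
      rw [hmulT, he, hi, hi, mul_assoc] at h3
      have hμ0 : i (μ j) ≠ 0 := (map_ne_zero i).2 (inv_ne_zero (pow_ne_zero _ hη0))
      rw [Module.End.mem_eigenspace_iff, one_smul, eq_inv_mul_iff_mul_eq₀ (he0 j)]
      exact mul_left_cancel₀ hμ0 h3
    exact ⟨{ toFun := fun x => ⟨e j * x, h1 _ x.2⟩
             invFun := fun y => ⟨(e j)⁻¹ * y, h2 _ y.2⟩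
             map_add' := fun x y => Subtype.ext (mul_add _ _ _)
             map_smul' := fun c x => Subtype.ext (by simp)
             left_inv := fun x => Subtype.ext (inv_mul_cancel_left₀ (he0 j) _)
             right_inv := fun x => Subtype.ext (mul_inv_cancel_left₀ (he0 j) _) }⟩
  have : FiniteDimensional K D := FiniteDimensional.right F K D
  have hKD : Module.finrank K D = N * m ^ 2 := by
    have := Module.finrank_mul_finrank F K D
    rw [hK, hD, mul_pow, sq N, mul_assoc] at this
    exact Nat.eq_of_mul_eq_mul_left hN this
  -- Left multiplication by `e j` is `F`-linear but need not be `K`-linear, so `F`-dimensions are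
  -- compared and the degree of `K` over `F` is cancelled.
  have hdim : ∀ j, Module.finrank K (T.eigenspace (μ j)) = Module.finrank K (T.eigenspace 1) :=
    fun j => Nat.eq_of_mul_eq_mul_left hN (by
      rw [← hK, Module.finrank_mul_finrank, Module.finrank_mul_finrank]
      exact (hequiv j).some.finrank_eq.symm)
  have hdim1 : Module.finrank K (T.eigenspace 1) = m ^ 2 := by
    have h1 := finrank_eq_of_iSup_eigenspace_eq_top T μ hμ htop hdim
    rw [hKD] at h1
    exact (Nat.eq_of_mul_eq_mul_left hN h1).symm
  obtain ⟨b, hb, hTb⟩ := exists_linearIndependent_eigenvectors T μ hμ htop fun j =>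
    (hdim j).trans hdim1
  have h4 : LinearIndependent K fun p : Fin (m ^ 2) × Fin N =>
      (T ^ (p.2 : ℕ)) (∑ j, b (j, p.1)) := linearIndependent_pow_apply_sum T μ hμ b hb hTb
  have hfin := linearIndependent_pow_apply_smul (F := F) T (fun s : Fin (m ^ 2) => ∑ j, b (j, s)) h4
    (fun k : Fin N => z ^ (k : ℕ)) hlin
  refine ⟨fun t => z ^ ((finProdFinEquiv.symm t).1 : ℕ) •
    ∑ j, b (j, (finProdFinEquiv.symm t).2), ?_⟩
  rw [← linearIndependent_equiv (Equiv.prodCongr finProdFinEquiv (Equiv.refl (Fin N)))]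
  convert hfin using 1
  · ext ⟨⟨l, s⟩, k⟩
    simp only [Function.comp_apply, conjEnd_pow_apply, hTdef]
    simp
  · rfl

end Conj

/-! ### Powers of an element with `z ^ 2 ^ n = -1`. -/

section Field

open Polynomial

theorem isPrimitiveRoot_sq_of_pow_eq_neg_one {K : Type*} [Field K] [CharZero K] {z : K} {n : ℕ}
    (hz : z ^ 2 ^ n = -1) : IsPrimitiveRoot z (2 ^ (n + 1)) ∧ IsPrimitiveRoot (z ^ 2) (2 ^ n) := by
  have h : orderOf z = 2 ^ (n + 1) := by
    refine orderOf_eq_prime_pow ?_ ?_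
    · rw [hz]
      norm_num
    · rw [pow_succ, pow_mul, hz]
      norm_num
  have h1 : IsPrimitiveRoot z (2 ^ (n + 1)) := h ▸ IsPrimitiveRoot.orderOf z
  exact ⟨h1, h1.pow (by positivity) (by rw [pow_succ, mul_comm])⟩

theorem minpoly_eq_X_pow_add_one {B : Type*} [Ring B] [Nontrivial B] [Algebra ℚ_[2] B] {z : B} {n : ℕ}
    (hz : z ^ 2 ^ n = -1) : minpoly ℚ_[2] z = X ^ 2 ^ n + 1 := by
  symm
  refine minpoly.eq_of_irreducible_of_monic (irreducible_X_pow_add_one_padic n) ?_ ?_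
  · simp [hz]
  · rw [← C_1]
    exact monic_X_pow_add_C 1 (by positivity)

theorem natDegree_minpoly_of_pow_eq_neg_one {B : Type*} [Ring B] [Nontrivial B] [Algebra ℚ_[2] B]
    {z : B} {n : ℕ} (hz : z ^ 2 ^ n = -1) : (minpoly ℚ_[2] z).natDegree = 2 ^ n := by
  rw [minpoly_eq_X_pow_add_one hz, ← C_1, natDegree_X_pow_add_C]

theorem linearIndependent_pow_of_pow_eq_neg_one {B : Type*} [Ring B] [Nontrivial B]
    [Algebra ℚ_[2] B] {z : B} {n : ℕ} (hz : z ^ 2 ^ n = -1) :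
    LinearIndependent ℚ_[2] fun k : Fin (2 ^ n) => z ^ (k : ℕ) := by
  have h := linearIndependent_pow (K := ℚ_[2]) z
  exact h.comp (Fin.cast (natDegree_minpoly_of_pow_eq_neg_one hz).symm) (Fin.cast_injective _)

end Field

/-! ### Free conjugation orbits in the division algebra over `ℚ_2`. -/

section Padic

open Polynomial

theorem exists_linearIndependent_conj_pow_padic {D : Type*} [DivisionRing D] [Algebra ℚ_[2] D]
    [Algebra.IsCentral ℚ_[2] D] [FiniteDimensional ℚ_[2] D] {n m : ℕ}
    (hD : Module.finrank ℚ_[2] D = (2 ^ n * m) ^ 2) (ζ : D) (hζ : ζ ^ 2 ^ n = -1) :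
    ∃ y : Fin (2 ^ n * m ^ 2) → D, LinearIndependent ℚ_[2]
      fun p : Fin (2 ^ n * m ^ 2) × Fin (2 ^ n) =>
        ζ ^ (p.2 : ℕ) * y p.1 * (ζ ^ (p.2 : ℕ))⁻¹ := by
  set f : ℚ_[2][X] := X ^ 2 ^ n + 1 with hf
  have : Fact (Irreducible f) := ⟨irreducible_X_pow_add_one_padic n⟩
  -- An abstract model of `ℚ_2(ζ)`, mapped into `D` by sending the root to `ζ`, so that `D` becomes
  -- a left vector space over a field.
  let i : AdjoinRoot f →ₐ[ℚ_[2]] D := Ideal.Quotient.liftₐ (Ideal.span {f}) (aeval ζ) (by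
    intro a ha
    obtain ⟨c, rfl⟩ := Ideal.mem_span_singleton.1 ha
    simp [hf, hζ])
  have hiz : i (AdjoinRoot.root f) = ζ := aeval_X ζ
  have hz : AdjoinRoot.root f ^ 2 ^ n = -1 := by
    apply (i : AdjoinRoot f →+* D).injective
    change i _ = i _
    rw [map_pow, hiz, hζ, map_neg, map_one]
  let _ : Module (AdjoinRoot f) D := Module.compHom D (i : AdjoinRoot f →+* D)
  have hi : ∀ (x : AdjoinRoot f) (d : D), x • d = i x * d := fun _ _ => rfl
  have : IsScalarTower ℚ_[2] (AdjoinRoot f) D := ⟨fun a x d => by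
    rw [hi, hi, map_smul, smul_mul_assoc]⟩
  have : CharZero (AdjoinRoot f) :=
    charZero_of_injective_algebraMap (algebraMap ℚ_[2] (AdjoinRoot f)).injective
  have hfin : Module.finrank ℚ_[2] (AdjoinRoot f) = 2 ^ n := by
    rw [(AdjoinRoot.powerBasis (Fact.out (p := Irreducible f)).ne_zero).finrank,
      AdjoinRoot.powerBasis_dim, hf, ← C_1, natDegree_X_pow_add_C]
  obtain ⟨y, hy⟩ := exists_linearIndependent_conj_pow i hi (AdjoinRoot.root f) (by positivity) hz
    (isPrimitiveRoot_sq_of_pow_eq_neg_one hz).2 hfin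
    (linearIndependent_pow_of_pow_eq_neg_one hz) hD
  rw [hiz] at hy
  exact ⟨y, hy⟩

end Padic

/-! ### Elements inducing Galois automorphisms by conjugation. -/

section Galois

variable {F L D : Type*} [Field F] [Field L] [Algebra F L] [DivisionRing D] [Algebra F D]
  [Module L D] (i : L →ₐ[F] D) (hi : ∀ (x : L) (d : D), x • d = i x * d)

include hi in
-- Right multiplication by a primitive element `θ` is `L`-linear for the left structure, and `e φ`
-- is an eigenvector with eigenvalue `φ θ`; these values are distinct.
theorem linearIndependent_of_mul_eq_algEquiv_mul [FiniteDimensional F L] [Algebra.IsSeparable F L]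
    (e : (L ≃ₐ[F] L) → D) (he0 : ∀ φ, e φ ≠ 0) (he : ∀ φ x, e φ * i x = i (φ x) * e φ) :
    LinearIndependent L e := by
  obtain ⟨θ, hθ⟩ := Field.exists_primitive_element F L
  let R : Module.End L D :=
    { toFun := fun d => d * i θ
      map_add' := fun x y => add_mul _ _ _
      map_smul' := fun c x => by simp [hi, mul_assoc] }
  refine Module.End.eigenvectors_linearIndependent' R (fun φ => φ θ) ?_ e fun φ => ⟨?_, he0 φ⟩
  · intro φ ψ h
    have htop : Algebra.adjoin F {θ} = ⊤ := by
      rw [← IntermediateField.adjoin_simple_toSubalgebra_of_isAlgebraic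
        (Algebra.IsAlgebraic.isAlgebraic θ), hθ, IntermediateField.top_toSubalgebra]
    refine AlgEquiv.coe_toAlgHom_injective (AlgHom.ext_of_adjoin_eq_top htop ?_)
    rintro x rfl
    exact h
  · rw [Module.End.mem_genEigenspace_one]
    exact (he φ θ).trans (hi _ _).symm

include hi in
-- From `e φ * z = φ z * e φ`, conjugation by `z` multiplies `e φ` by `z * (φ z)⁻¹`. This is `z ^
-- (-2 * j)` when `φ z = z ^ (2 * j + 1)`, so the Vandermonde argument applies to these explicit
-- eigenvectors.
theorem linearIndependent_conj_pow_sum [FiniteDimensional F L] [Algebra.IsSeparable F L]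
    [IsScalarTower F L D] (e : (L ≃ₐ[F] L) → D) (he0 : ∀ φ, e φ ≠ 0)
    (he : ∀ φ x, e φ * i x = i (φ x) * e φ) (z : L) {N m : ℕ}
    (hN : 0 < N) (hprim : IsPrimitiveRoot (z ^ 2) N)
    (Φ : Fin N × Fin m ≃ (L ≃ₐ[F] L)) (hΦ : ∀ j s, Φ (j, s) z = z ^ (2 * (j : ℕ) + 1))
    {ι : Type*} (x : ι → L) (hx : LinearIndependent F x) :
    LinearIndependent F fun p : (ι × Fin m) × Fin N =>
      i z ^ (p.2 : ℕ) * (i (x p.1.1) * ∑ j, e (Φ (j, p.1.2))) * (i z ^ (p.2 : ℕ))⁻¹ := by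
  have hz0 : z ≠ 0 := by
    rintro rfl
    exact hprim.ne_zero hN.ne' (by simp)
  have hiz0 : i z ≠ 0 := (map_ne_zero i).2 hz0
  set μ : Fin N → L := fun j => ((z ^ 2) ^ (j : ℕ))⁻¹ with hμdef
  have hμ : Function.Injective μ := fun j j' h =>
    Fin.ext (hprim.pow_inj j.2 j'.2 (inv_injective h))
  have hT : ∀ j s, conjEnd i hi z (e (Φ (j, s))) = μ j • e (Φ (j, s)) := by
    intro j s
    rw [conjEnd_apply, mul_inv_eq_iff_eq_mul₀ hiz0, hi, mul_assoc, he, hΦ, ← mul_assoc, ← map_mul]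
    congr 2
    simp only [hμdef]
    rw [pow_succ z (2 * _), pow_mul, inv_mul_cancel_left₀ (pow_ne_zero _ (pow_ne_zero _ hz0))]
  have h1 : LinearIndependent L fun p => e (Φ p) :=
    (linearIndependent_of_mul_eq_algEquiv_mul i hi e he0 he).comp Φ Φ.injective
  have h2 : LinearIndependent L fun p : Fin m × Fin N =>
      (conjEnd i hi z ^ (p.2 : ℕ)) (∑ j, e (Φ (j, p.1))) :=
    linearIndependent_pow_apply_sum (conjEnd i hi z) μ hμ (fun p => e (Φ p)) h1 hT
  have h3 := linearIndependent_pow_apply_smul (F := F) (conjEnd i hi z)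
    (fun s : Fin m => ∑ j, e (Φ (j, s))) h2 x hx
  simp only [conjEnd_pow_apply, hi] at h3
  exact h3

/-- The automorphisms with prescribed value at a primitive root of unity of order `2 ^ (n + 1)` are
equidistributed. -/
theorem exists_equiv_algEquiv [FiniteDimensional F L] [IsGalois F L] [CharZero L] {n m : ℕ}
    (z w : L) (hz : z ^ 2 ^ n = -1) (hw : (minpoly F w).natDegree = m)
    (hL : Algebra.adjoin F {z, w} = ⊤) (hfin : Module.finrank F L = 2 ^ n * m) :
    ∃ Φ : Fin (2 ^ n) × Fin m ≃ (L ≃ₐ[F] L), ∀ j s, Φ (j, s) z = z ^ (2 * (j : ℕ) + 1) := by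
  classical
  obtain ⟨hprim, -⟩ := isPrimitiveRoot_sq_of_pow_eq_neg_one hz
  have hex : ∀ φ : L ≃ₐ[F] L, ∃ j : Fin (2 ^ n), φ z = z ^ (2 * (j : ℕ) + 1) := by
    intro φ
    have h1 : IsPrimitiveRoot (φ z) (2 ^ (n + 1)) := hprim.map_of_injective φ.injective
    obtain ⟨a, ha, hcop, h2⟩ := hprim.isPrimitiveRoot_iff.1 h1
    have hodd : Odd a := by
      rw [← Nat.coprime_two_right]
      exact hcop.coprime_dvd_right (dvd_pow_self 2 (by omega))
    obtain ⟨j, rfl⟩ := hodd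
    exact ⟨⟨j, by rw [pow_succ] at ha; omega⟩, h2.symm⟩
  choose J hJ using hex
  -- With its value at `z` fixed, an automorphism is determined by its value at `w`, one of at most
  -- `m` roots of the minimal polynomial. The total `2 ^ n * m` then forces equality in every fibre.
  have hle : ∀ j, Fintype.card {φ // J φ = j} ≤ m := by
    intro j
    have hw0 : minpoly F w ≠ 0 := minpoly.ne_zero (Algebra.IsIntegral.isIntegral w)
    have hmem : ∀ φ : L ≃ₐ[F] L, φ w ∈ (minpoly F w).aroots L := by
      intro φ
      rw [Polynomial.mem_aroots]
      refine ⟨hw0, ?_⟩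
      rw [Polynomial.aeval_algHom_apply, minpoly.aeval, map_zero]
    have hinj : Function.Injective fun φ : {φ // J φ = j} =>
        (⟨(φ : L ≃ₐ[F] L) w, Multiset.mem_toFinset.2 (hmem φ)⟩ :
          ((minpoly F w).aroots L).toFinset) := by
      rintro ⟨φ, hφ⟩ ⟨ψ, hψ⟩ h
      have h1 : φ w = ψ w := congrArg Subtype.val h
      have h2 : φ z = ψ z := by rw [hJ, hJ, hφ, hψ]
      refine Subtype.ext (AlgEquiv.coe_toAlgHom_injective (AlgHom.ext_of_adjoin_eq_top hL ?_))
      rintro x (rfl | rfl)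
      · exact h2
      · exact h1
    refine (Fintype.card_le_of_injective _ hinj).trans ?_
    rw [Fintype.card_coe, ← hw]
    exact (Multiset.toFinset_card_le _).trans (Polynomial.card_roots_map_le_natDegree _)
  have hcard : ∀ j, Fintype.card {φ // J φ = j} = m := by
    have hsum : ∑ j, Fintype.card {φ // J φ = j} = ∑ _j : Fin (2 ^ n), m := by
      rw [← Fintype.card_sigma, Fintype.card_congr (Equiv.sigmaFiberEquiv J),
        ← Nat.card_eq_fintype_card, IsGalois.card_aut_eq_finrank, hfin]
      simp
    intro j
    exact (Finset.sum_eq_sum_iff_of_le fun j _ => hle j).1 hsum j (Finset.mem_univ _)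
  let Ψ : Fin (2 ^ n) × Fin m ≃ (L ≃ₐ[F] L) := (Equiv.sigmaEquivProd _ _).symm.trans
    ((Equiv.sigmaCongrRight fun j => (Fintype.equivFinOfCardEq (hcard j)).symm).trans
      (Equiv.sigmaFiberEquiv J))
  refine ⟨Ψ, fun j s => ?_⟩
  have : J (Ψ (j, s)) = j := ((Fintype.equivFinOfCardEq (hcard j)).symm s).2
  rw [hJ, this]

end Galois

/-! ### The lattice: stability, rank and free orbits inside it. -/

section Lattice

variable {F L D : Type*} [Field F] [Field L] [Algebra F L] [DivisionRing D] [Algebra F D]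
  (i : L →ₐ[F] D)

/-- The spanning set of the lattice is stable under conjugation by `i z`. -/
theorem conj_mem_latticeSpan {A : Type*} {n : ℕ} (z : L) (hz : z ^ 2 ^ n = -1) (b : A → L)
    (e : (L ≃ₐ[F] L) → D) (he : ∀ φ x, e φ * i x = i (φ x) * e φ)
    (hφ : ∀ φ : L ≃ₐ[F] L, ∃ c : ℕ, φ z = z ^ c) (k : ℕ) :
    ∀ x ∈ latticeSpan (i z) (2 ^ n) (fun a => i (b a)) e,
      i z ^ k * x * (i z ^ k)⁻¹ ∈ latticeSpan (i z) (2 ^ n) (fun a => i (b a)) e := by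
  have hz0 : z ≠ 0 := by
    rintro rfl
    rw [zero_pow (by positivity)] at hz
    simp at hz
  -- Exponents beyond the range `j < 2 ^ n` cost only a sign, since `z ^ 2 ^ n = -1`; a subgroup
  -- absorbs it.
  have hpow : ∀ (j : ℕ) a φ, i (z ^ j * b a) * e φ ∈
      latticeSpan (i z) (2 ^ n) (fun a => i (b a)) e := by
    intro j a φ
    have h1 : i (z ^ (j % 2 ^ n) * b a) * e φ ∈
        latticeSpan (i z) (2 ^ n) (fun a => i (b a)) e :=
      Submodule.subset_span ⟨j % 2 ^ n, Nat.mod_lt _ (by positivity), a, φ, by simp⟩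
    rw [← Nat.mod_add_div j (2 ^ n), pow_add, pow_mul, hz]
    rcases neg_one_pow_eq_or L (j / 2 ^ n) with h | h
    · rwa [h, mul_one]
    · rw [h]
      simpa using Submodule.neg_mem _ h1
  have hinv : ∀ c : ℕ, (z ^ c)⁻¹ = z ^ (c * (2 ^ (n + 1) - 1)) := by
    intro c
    rw [inv_eq_iff_eq_inv, eq_comm, inv_eq_of_mul_eq_one_left]
    rw [pow_mul, ← pow_succ', Nat.sub_add_cancel Nat.one_le_two_pow, pow_succ, pow_mul,
      ← pow_mul z, mul_comm c, pow_mul z, hz, ← pow_mul, mul_comm c, pow_mul]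
    simp
  intro x hx
  induction hx using Submodule.span_induction with
  | mem x hx =>
    obtain ⟨j, hj, a, φ, rfl⟩ := hx
    obtain ⟨c, hc⟩ := hφ φ
    -- Moving `(z ^ k)⁻¹` to the left past `e φ` turns it into a power of `z`, because `φ z` is one.
    have h1 : e φ * (i z ^ k)⁻¹ = i ((z ^ (c * k))⁻¹) * e φ := by
      rw [← map_pow, ← map_inv₀, he, map_inv₀ φ, map_pow φ, hc, pow_mul]
    rw [mul_assoc, mul_assoc, h1, hinv]
    have h2 := hpow (k + j + c * k * (2 ^ (n + 1) - 1)) a φ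
    have h3 : z ^ k * z ^ j * b a * z ^ (c * k * (2 ^ (n + 1) - 1)) =
        z ^ (k + j + c * k * (2 ^ (n + 1) - 1)) * b a := by ring
    rw [← h3] at h2
    simpa only [map_mul, map_pow, mul_assoc] using h2
  | zero => simp
  | add x y _ _ hx hy => simpa [mul_add, add_mul] using add_mem hx hy
  | smul c x _ hx =>
    rw [mul_smul_comm, smul_mul_assoc]
    exact Submodule.smul_mem _ _ hx

variable [Module L D] (hi : ∀ (x : L) (d : D), x • d = i x * d)

include hi in
theorem finrank_latticeSpan [CharZero F] [FiniteDimensional F L] [Algebra.IsSeparable F L]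
    [IsScalarTower F L D] {N m : ℕ} (z : L) (b : Fin m → L)
    (hzb : LinearIndependent F fun p : Fin N × Fin m => z ^ (p.1 : ℕ) * b p.2)
    (e : (L ≃ₐ[F] L) → D) (he0 : ∀ φ, e φ ≠ 0) (he : ∀ φ x, e φ * i x = i (φ x) * e φ) :
    Module.finrank ℤ (latticeSpan (i z) N (fun a => i (b a)) e) =
      N * m * Nat.card (L ≃ₐ[F] L) := by
  have h1 : LinearIndependent F fun p : (Fin N × Fin m) × (L ≃ₐ[F] L) =>
      (z ^ (p.1.1 : ℕ) * b p.1.2) • e p.2 :=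
    linearIndependent_smul (b := fun p : Fin N × Fin m => z ^ (p.1 : ℕ) * b p.2) (c := e) hzb
      (linearIndependent_of_mul_eq_algEquiv_mul i hi e he0 he)
  have h2 : LinearIndependent ℤ fun p : (Fin N × Fin m) × (L ≃ₐ[F] L) =>
      (z ^ (p.1.1 : ℕ) * b p.1.2) • e p.2 :=
    h1.restrict_scalars' ℤ
  have h3 : latticeSpan (i z) N (fun a => i (b a)) e =
      Submodule.span ℤ (Set.range fun p : (Fin N × Fin m) × (L ≃ₐ[F] L) =>
        (z ^ (p.1.1 : ℕ) * b p.1.2) • e p.2) := by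
    refine congrArg _ (Set.ext fun x => ⟨?_, ?_⟩)
    · rintro ⟨j, hj, a, φ, rfl⟩
      exact ⟨((⟨j, hj⟩, a), φ), by simp [hi]⟩
    · rintro ⟨⟨⟨j, a⟩, φ⟩, rfl⟩
      exact ⟨j, j.2, a, φ, by simp [hi]⟩
  rw [h3, Module.finrank_eq_nat_card_basis (Module.Basis.span h2)]
  simp

include hi in
-- The generators are a basis element of `L` times a sum of elements `e φ`, hence sums of spanning
-- vectors of the lattice. Their number is `(N * m) * m`.
theorem exists_linearIndependent_conj_pow_latticeSpan [CharZero F] [FiniteDimensional F L]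
    [Algebra.IsSeparable F L] [IsScalarTower F L D] {N m : ℕ} (hN : 0 < N) (z : L)
    (hprim : IsPrimitiveRoot (z ^ 2) N) (b : Fin m → L)
    (hzb : LinearIndependent F fun p : Fin N × Fin m => z ^ (p.1 : ℕ) * b p.2)
    (e : (L ≃ₐ[F] L) → D) (he0 : ∀ φ, e φ ≠ 0) (he : ∀ φ x, e φ * i x = i (φ x) * e φ)
    (Φ : Fin N × Fin m ≃ (L ≃ₐ[F] L)) (hΦ : ∀ j s, Φ (j, s) z = z ^ (2 * (j : ℕ) + 1)) :
    ∃ y : Fin (N * m ^ 2) → latticeSpan (i z) N (fun a => i (b a)) e,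
      LinearIndependent ℤ fun p : Fin (N * m ^ 2) × Fin N =>
        i z ^ (p.2 : ℕ) * (y p.1 : D) * (i z ^ (p.2 : ℕ))⁻¹ := by
  have h := (linearIndependent_conj_pow_sum i hi e he0 he z hN hprim Φ hΦ _ hzb).restrict_scalars' ℤ
  let E : ((Fin N × Fin m) × Fin m) ≃ Fin (N * m ^ 2) :=
    Fintype.equivFinOfCardEq (by simp [sq, mul_assoc])
  refine ⟨fun t => ⟨i (z ^ ((E.symm t).1.1 : ℕ) * b (E.symm t).1.2) *
    ∑ j, e (Φ (j, (E.symm t).2)), ?_⟩, ?_⟩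
  · rw [Finset.mul_sum]
    exact Submodule.sum_mem _ fun j _ => Submodule.subset_span
      ⟨_, (E.symm t).1.1.2, _, _, by rw [map_mul, map_pow]⟩
  · rw [← linearIndependent_equiv (Equiv.prodCongr E (Equiv.refl (Fin N)))]
    convert h using 1
    ext p
    simp

end Lattice

/-! ### Adding the induced sign representation, and passage to real coefficients. -/

section Real

theorem nonempty_prod_indSign_equiv {k C V : Type*} [Field k] [CommGroup C] [Finite C]
    [AddCommGroup V] [Module k V] (h2k : (2 : k) ≠ 0) (h2 : Nat.card (subgroupC₂ C) = 2)
    {ρ : Representation k C V} {M : ℕ} (e : ρ.Equiv (copies M (quotientRegularRep k C))) :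
    Nonempty ((ρ.prod (copies M (indSign k C))).Equiv
      (copies M (Representation.leftRegular k C))) := by
  obtain ⟨f⟩ := nonempty_quotientRegularRep_prod_indSign (k := k) h2k h2
  obtain ⟨f'⟩ := nonempty_copies_prod M f
  refine ⟨(Representation.Equiv.mk (LinearEquiv.prodCongr e.toLinearEquiv
    (LinearEquiv.refl k _)) fun g => LinearMap.ext fun x => Prod.ext ?_ rfl).trans f'⟩
  exact LinearMap.congr_fun (e.toIntertwiningMap.isIntertwining' g) x.1

/-- Flatness of `ℝ` over `ℤ` keeps the orbits independent, and the rank is the real dimension; the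
orbits need not generate the lattice itself. -/
theorem nonempty_realification_equiv {C L : Type*} [CommGroup C] [Finite C] [AddCommGroup L]
    [Module.Free ℤ L] [Module.Finite ℤ L]
    (ρ : Representation ℤ C L) (M N : ℕ) (hN : 0 < N) (hM : 0 < M) (hC : Nat.card C = 2 * N)
    (h2 : Nat.card (subgroupC₂ C) = 2) (γ : C) (hγ : ∀ g : C, g ∈ Subgroup.zpowers γ)
    (hρ : ρ (γ ^ N) = 1) (y : Fin M → L)
    (hy : LinearIndependent ℤ fun p : Fin M × Fin N => ρ (γ ^ (p.2 : ℕ)) (y p.1))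
    (hL : Module.finrank ℤ L = M * N) :
    Nonempty ((realification ρ).Equiv (copies M (quotientRegularRep ℝ C))) := by
  have happ : ∀ g x, realification ρ g ((1 : ℝ) ⊗ₜ[ℤ] x) = (1 : ℝ) ⊗ₜ[ℤ] ρ g x := fun g x =>
    LinearMap.baseChange_tmul _ _ _
  refine nonempty_equiv_of_linearIndependent (realification ρ) M N hN hM hC h2 γ hγ ?_
    (fun t => (1 : ℝ) ⊗ₜ[ℤ] y t) ?_ ?_
  · change Module.End.baseChangeHom ℤ ℝ L (ρ (γ ^ N)) = 1
    rw [hρ, map_one]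
  · simp only [happ]
    exact Module.Flat.linearIndependent_one_tmul hy
  · rw [Module.finrank_baseChange, hL]

end Real

/-! ### The Lie algebra as the division algebra with the conjugation action. -/

section Lie

variable (p : ℕ) [Fact p.Prime] (D : Type*) [NormedDivisionRing D] [NormedAlgebra ℚ_[p] D]
  [FiniteDimensional ℚ_[p] D]

/-- The inclusion into `D` is the chart that defines the manifold structure. -/
theorem isInvertible_mfderiv_stabilizer_val (u : Stabilizer p D) :
    (mfderiv 𝓘(ℚ_[p], D) 𝓘(ℚ_[p], D)
      (fun u : Stabilizer p D => ((u : maximalOrder p D) : D)) u).IsInvertible := by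
  exact isInvertible_mfderiv_extChartAt (I := 𝓘(ℚ_[p], D)) (mem_extChartAt_source (I := 𝓘(ℚ_[p], D)) u)

/-- The derivative of the inclusion `𝒪_D^× → D` at the identity. -/
def stabilizerValDeriv : D →L[ℚ_[p]] D :=
  mfderiv 𝓘(ℚ_[p], D) 𝓘(ℚ_[p], D)
    (fun u : Stabilizer p D => ((u : maximalOrder p D) : D)) (1 : Stabilizer p D)

/-- Conjugation on the group is the restriction of the continuous linear map `c` on `D`, which is
its own derivative; the chain rule gives the formula. -/
theorem stabilizerValDeriv_adjointMap (u : Stabilizer p D) (v : D) :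
    stabilizerValDeriv p D (adjointMap 𝓘(ℚ_[p], D) (Stabilizer p D) u v : D) =
      (Stabilizer.toUnits p D u : D) * stabilizerValDeriv p D v *
        ((Stabilizer.toUnits p D u)⁻¹ : Dˣ) := by
  set val := fun u : Stabilizer p D => ((u : maximalOrder p D) : D) with hval
  have hvald : MDifferentiable 𝓘(ℚ_[p], D) 𝓘(ℚ_[p], D) val :=
    (contMDiff_stabilizer_val p D).mdifferentiable (by simp)
  let c : D →L[ℚ_[p]] D := (ContinuousLinearMap.mul ℚ_[p] D (Stabilizer.toUnits p D u)).comp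
    ((ContinuousLinearMap.mul ℚ_[p] D).flip (((Stabilizer.toUnits p D u)⁻¹ : Dˣ) : D))
  have hc : ∀ x, c x = Stabilizer.toUnits p D u * x * ((Stabilizer.toUnits p D u)⁻¹ : Dˣ) :=
    fun x => by simp [c, mul_assoc]
  have hcomp : val ∘ conjMap u = c ∘ val := by
    ext x
    rw [Function.comp_apply, Function.comp_apply, hc, ← map_inv]
    rfl
  have h1 := mfderiv_comp_of_eq (x := (1 : Stabilizer p D)) (y := 1) (hvald 1)
    (mdifferentiable_conjMap 𝓘(ℚ_[p], D) (Stabilizer p D) u 1) (conjMap_one u)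
  have h1' : (mfderiv 𝓘(ℚ_[p], D) 𝓘(ℚ_[p], D) (val ∘ conjMap u) (1 : Stabilizer p D) v : D) =
      stabilizerValDeriv p D (adjointMap 𝓘(ℚ_[p], D) (Stabilizer p D) u v : D) := by
    rw [h1, conjMap_one]
    rfl
  have h2 := mfderiv_comp (1 : Stabilizer p D) (c.mdifferentiableAt (x := val 1)) (hvald 1)
  have h2' : (mfderiv 𝓘(ℚ_[p], D) 𝓘(ℚ_[p], D) (c ∘ val) (1 : Stabilizer p D) v : D) =
      c (stabilizerValDeriv p D v) := by
    rw [h2, c.mfderiv_eq]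
    rfl
  rw [← hc, ← h2', ← h1', hcomp]

variable {E : Type*} [NormedAddCommGroup E] [NormedSpace ℚ_[p] E]
  {G : Type*} [TopologicalSpace G] [Group G] [ChartedSpace E G] [LieGroup 𝓘(ℚ_[p], E) ω G]

/-- The Lie algebra of a Lie group that contains the stabilizer group as an open subgroup is the
division algebra with the conjugation action. -/
theorem exists_linearEquiv_groupLieAlgebra (j : Stabilizer p D →* G)
    (hjd : IsLocalDiffeomorph 𝓘(ℚ_[p], D) 𝓘(ℚ_[p], E) ω j) :
    ∃ Λ : D ≃ₗ[ℚ_[p]] GroupLieAlgebra 𝓘(ℚ_[p], E) G, ∀ (u : Stabilizer p D) (x : D),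
      adjointRep 𝓘(ℚ_[p], E) G (j u) (Λ x) =
        Λ (Stabilizer.toUnits p D u * x * ((Stabilizer.toUnits p D u)⁻¹ : Dˣ)) := by
  obtain ⟨A, hA⟩ := isInvertible_mfderiv_stabilizer_val p D 1
  let A' : D ≃ₗ[ℚ_[p]] D := A.toLinearEquiv
  have hA' : ∀ v, A' v = stabilizerValDeriv p D v := fun v => DFunLike.congr_fun hA v
  let B : D ≃ₗ[ℚ_[p]] E :=
    (hjd.mfderivToContinuousLinearEquiv (by simp) (1 : Stabilizer p D)).toLinearEquiv
  have hB : ∀ v : D, B v = (mfderiv 𝓘(ℚ_[p], D) 𝓘(ℚ_[p], E) j 1 v : E) := fun v => rfl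
  have hjm : MDifferentiable 𝓘(ℚ_[p], D) 𝓘(ℚ_[p], E) j := hjd.mdifferentiable (by simp)
  -- The identity `conjMap (j u) ∘ j = j ∘ conjMap u` is differentiated at `1`.
  have hBconj : ∀ (u : Stabilizer p D) (v : D),
      (adjointMap 𝓘(ℚ_[p], E) G (j u) (B v) : E) =
        B (adjointMap 𝓘(ℚ_[p], D) (Stabilizer p D) u v : D) := by
    intro u v
    have hcomp : conjMap (j u) ∘ j = j ∘ conjMap u := by
      ext x
      simp [conjMap]
    have h1 := mfderiv_comp_of_eq (x := (1 : Stabilizer p D)) (y := 1) (hjm 1)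
      (mdifferentiable_conjMap 𝓘(ℚ_[p], D) (Stabilizer p D) u 1) (conjMap_one u)
    have h2 := mfderiv_comp_of_eq (x := (1 : Stabilizer p D)) (y := 1)
      (mdifferentiable_conjMap 𝓘(ℚ_[p], E) G (j u) 1) (hjm 1) (map_one j)
    have h1' : (mfderiv 𝓘(ℚ_[p], D) 𝓘(ℚ_[p], E) (j ∘ conjMap u) (1 : Stabilizer p D) v : E) =
        B (adjointMap 𝓘(ℚ_[p], D) (Stabilizer p D) u v : D) := by
      rw [h1, conjMap_one]
      rfl
    have h2' : (mfderiv 𝓘(ℚ_[p], D) 𝓘(ℚ_[p], E) (conjMap (j u) ∘ j) (1 : Stabilizer p D) v : E) =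
        (adjointMap 𝓘(ℚ_[p], E) G (j u) (B v) : E) := by
      rw [h2, map_one]
      rfl
    exact h2'.symm.trans (Eq.trans (by rw [hcomp]) h1')
  refine ⟨A'.symm.trans B, fun u x => ?_⟩
  obtain ⟨v, rfl⟩ := A'.surjective x
  change (adjointMap 𝓘(ℚ_[p], E) G (j u) (B (A'.symm (A' v))) : E) = B (A'.symm _)
  rw [A'.symm_apply_apply, hBconj]
  refine congrArg B ((LinearEquiv.eq_symm_apply A').2 ?_)
  rw [hA' v]
  exact (hA' _).trans (stabilizerValDeriv_adjointMap p D u v)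

end Lie

/-! ### The field generated by `ζ` and `w` over `ℚ_2`. -/

section Cyclotomic

variable {L : Type*} [Field L] [Algebra ℚ_[2] L] [FiniteDimensional ℚ_[2] L]

theorem isGalois_of_adjoin_eq_top {F L : Type*} [Field F] [Field L] [Algebra F L] {z w : L} {k l : ℕ}
    (hz : IsPrimitiveRoot z k) (hw : IsPrimitiveRoot w l) (hk : k ≠ 0) (hl : l ≠ 0)
    (hL : Algebra.adjoin F {z, w} = ⊤) : IsGalois F L := by
  have : IsCyclotomicExtension {k, l} F L := by
    refine ⟨?_, fun x => ?_⟩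
    · rintro s (rfl | rfl) _
      · exact ⟨z, hz⟩
      · exact ⟨w, hw⟩
    · have hx : x ∈ Algebra.adjoin F {z, w} := hL ▸ Algebra.mem_top
      refine Algebra.adjoin_mono ?_ hx
      rintro y (rfl | rfl)
      · exact ⟨k, by simp, hk, hz.pow_eq_one⟩
      · exact ⟨l, by simp, hl, hw.pow_eq_one⟩
  exact IsCyclotomicExtension.isGalois {k, l} F L

/-- The degrees `2 ^ n` and `m` are coprime because `m` is odd. Both divide the degree of `L`, which
is at most their product, so equality holds and the two subfields are linearly disjoint. -/
theorem finrank_and_linearIndependent_of_adjoin_eq_top {n m : ℕ} (hm : Odd m) (z w : L)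
    (hz : z ^ 2 ^ n = -1) (hL : Algebra.adjoin ℚ_[2] {z, w} = ⊤)
    (b : Module.Basis (Fin m) ℚ_[2] (Algebra.adjoin ℚ_[2] ({w} : Set L))) :
    (minpoly ℚ_[2] w).natDegree = m ∧ Module.finrank ℚ_[2] L = 2 ^ n * m ∧
      LinearIndependent ℚ_[2] fun p : Fin (2 ^ n) × Fin m => z ^ (p.1 : ℕ) * (b p.2 : L) := by
  have hfz : Module.finrank ℚ_[2] (Algebra.adjoin ℚ_[2] ({z} : Set L)) = 2 ^ n := by
    rw [(Algebra.adjoin.powerBasis (Algebra.IsIntegral.isIntegral z)).finrank,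
      Algebra.adjoin.powerBasis_dim, natDegree_minpoly_of_pow_eq_neg_one hz]
  have hfw : Module.finrank ℚ_[2] (Algebra.adjoin ℚ_[2] ({w} : Set L)) = m := by
    rw [Module.finrank_eq_card_basis b, Fintype.card_fin]
  have hdeg : (minpoly ℚ_[2] w).natDegree = m := by
    rw [← hfw, (Algebra.adjoin.powerBasis (Algebra.IsIntegral.isIntegral w)).finrank,
      Algebra.adjoin.powerBasis_dim]
  have hcop : (2 ^ n).Coprime m := (Nat.coprime_two_left.2 hm).pow_left n
  have hdvd : ∀ x : L, (minpoly ℚ_[2] x).natDegree ∣ Module.finrank ℚ_[2] L := fun x =>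
    minpoly.degree_dvd (Algebra.IsIntegral.isIntegral x)
  have hsup : Algebra.adjoin ℚ_[2] ({z} : Set L) ⊔ Algebra.adjoin ℚ_[2] {w} = ⊤ := by
    rw [← Algebra.adjoin_union, Set.singleton_union, hL]
  have hle : Module.finrank ℚ_[2] L ≤ 2 ^ n * m := by
    have := Subalgebra.finrank_sup_le_of_free (Algebra.adjoin ℚ_[2] ({z} : Set L))
      (Algebra.adjoin ℚ_[2] ({w} : Set L))
    rwa [hsup, hfz, hfw, subalgebra_top_finrank_eq_submodule_top_finrank, finrank_top] at this
  have hfin : Module.finrank ℚ_[2] L = 2 ^ n * m := by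
    refine le_antisymm hle (Nat.le_of_dvd Module.finrank_pos (hcop.mul_dvd_of_dvd_of_dvd ?_ ?_))
    · rw [← natDegree_minpoly_of_pow_eq_neg_one hz]
      exact hdvd z
    · have := hdvd w
      rwa [hdeg] at this
  refine ⟨hdeg, hfin, ?_⟩
  have hmem : ∀ k : ℕ, z ^ k ∈ Algebra.adjoin ℚ_[2] ({z} : Set L) := fun k =>
    pow_mem (Algebra.self_mem_adjoin_singleton _ z) k
  have hind : LinearIndependent ℚ_[2] fun k : Fin (2 ^ n) =>
      (⟨z ^ (k : ℕ), hmem k⟩ : Algebra.adjoin ℚ_[2] ({z} : Set L)) :=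
    LinearIndependent.of_comp (Algebra.adjoin ℚ_[2] ({z} : Set L)).val.toLinearMap
      (linearIndependent_pow_of_pow_eq_neg_one hz)
  have hdisj : (Algebra.adjoin ℚ_[2] ({z} : Set L)).LinearDisjoint
      (Algebra.adjoin ℚ_[2] ({w} : Set L)) :=
    Subalgebra.LinearDisjoint.of_finrank_sup_of_free (by
      rw [hsup, hfz, hfw, subalgebra_top_finrank_eq_submodule_top_finrank, finrank_top, hfin])
  have := hdisj.linearIndependent_mul_of_flat_left
    (a := fun k : Fin (2 ^ n) => ⟨z ^ (k : ℕ), hmem k⟩) (b := fun t => b t) hind b.linearIndependent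
  exact this

end Cyclotomic

/-! ### The lattice for a subfield given inside the division algebra. -/

section Lattice

theorem finite_latticeSpan {D A Φ : Type*} [Ring D] [Finite A] [Finite Φ] (ζ : D) (N : ℕ)
    (b : A → D) (e : Φ → D) : Module.Finite ℤ (latticeSpan ζ N b e) := by
  have : {x | ∃ j < N, ∃ a φ, x = ζ ^ j * b a * e φ} ⊆
      Set.range fun p : Fin N × A × Φ => ζ ^ (p.1 : ℕ) * b p.2.1 * e p.2.2 := by
    rintro _ ⟨j, hj, a, φ, rfl⟩
    exact ⟨(⟨j, hj⟩, a, φ), rfl⟩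
  exact Module.Finite.span_of_finite ℤ ((Set.finite_range _).subset this)

theorem latticeSpan_properties_of_field {L D : Type*} [Field L] [Algebra ℚ_[2] L]
    [FiniteDimensional ℚ_[2] L] [DivisionRing D] [Algebra ℚ_[2] D] (i : L →ₐ[ℚ_[2]] D) {n m : ℕ}
    (hm : Odd m) (z w : L) (hz : z ^ 2 ^ n = -1) (hw : orderOf w = 2 ^ m - 1)
    (hL : Algebra.adjoin ℚ_[2] {z, w} = ⊤)
    (b : Module.Basis (Fin m) ℚ_[2] (Algebra.adjoin ℚ_[2] ({w} : Set L)))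
    (e : (L ≃ₐ[ℚ_[2]] L) → D) (he0 : ∀ φ, e φ ≠ 0) (he : ∀ φ x, e φ * i x = i (φ x) * e φ) :
    (∀ k, ∀ x ∈ latticeSpan (i z) (2 ^ n) (fun a => i (b a)) e,
      i z ^ k * x * (i z ^ k)⁻¹ ∈ latticeSpan (i z) (2 ^ n) (fun a => i (b a)) e) ∧
    Module.Finite ℤ (latticeSpan (i z) (2 ^ n) (fun a => i (b a)) e) ∧
    Module.finrank ℤ (latticeSpan (i z) (2 ^ n) (fun a => i (b a)) e) =
      2 ^ n * m ^ 2 * 2 ^ n ∧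
    ∃ y : Fin (2 ^ n * m ^ 2) → latticeSpan (i z) (2 ^ n) (fun a => i (b a)) e,
      LinearIndependent ℤ fun p : Fin (2 ^ n * m ^ 2) × Fin (2 ^ n) =>
        i z ^ (p.2 : ℕ) * (y p.1 : D) * (i z ^ (p.2 : ℕ))⁻¹ := by
  have : CharZero L := charZero_of_injective_algebraMap (algebraMap ℚ_[2] L).injective
  let _ : Module L D := Module.compHom D (i : L →+* D)
  have hi : ∀ (x : L) (d : D), x • d = i x * d := fun _ _ => rfl
  have : IsScalarTower ℚ_[2] L D := ⟨fun a x d => by rw [hi, hi, map_smul, smul_mul_assoc]⟩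
  obtain ⟨hdeg, hfin, hzb⟩ := finrank_and_linearIndependent_of_adjoin_eq_top hm z w hz hL b
  obtain ⟨hprim, hprim2⟩ := isPrimitiveRoot_sq_of_pow_eq_neg_one hz
  have h2m : 2 ^ m - 1 ≠ 0 := by
    have := Nat.one_lt_two_pow hm.pos.ne'
    omega
  have : IsGalois ℚ_[2] L := isGalois_of_adjoin_eq_top hprim (hw ▸ IsPrimitiveRoot.orderOf w)
    (by positivity) h2m hL
  obtain ⟨Φ, hΦ⟩ := exists_equiv_algEquiv z w hz hdeg hL hfin
  refine ⟨fun k => conj_mem_latticeSpan i z hz (fun a => (b a : L)) e he (fun φ => ?_) k,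
    finite_latticeSpan _ _ _ _, ?_,
    exists_linearIndependent_conj_pow_latticeSpan i hi (by positivity) z hprim2
      (fun a => (b a : L)) hzb e he0 he Φ hΦ⟩
  · obtain ⟨⟨j, s⟩, rfl⟩ := Φ.surjective φ
    exact ⟨_, hΦ j s⟩
  · rw [finrank_latticeSpan i hi z (fun a => (b a : L)) hzb e he0 he,
      IsGalois.card_aut_eq_finrank, hfin]
    ring

/-- The subalgebra generated by `ζ` and `w` in `D` comes only as a ring, so commutativity enters as
a hypothesis; a commutative domain of finite dimension over a field is a field. -/
theorem latticeSpan_properties_of_ring {L D : Type*} [Ring L] [IsDomain L] [Algebra ℚ_[2] L]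
    [FiniteDimensional ℚ_[2] L] (hc : ∀ x y : L, x * y = y * x) [DivisionRing D] [Algebra ℚ_[2] D]
    (i : L →ₐ[ℚ_[2]] D) {n m : ℕ} (hm : Odd m) (z w : L) (hz : z ^ 2 ^ n = -1)
    (hw : orderOf w = 2 ^ m - 1) (hL : Algebra.adjoin ℚ_[2] {z, w} = ⊤)
    (b : Module.Basis (Fin m) ℚ_[2] (Algebra.adjoin ℚ_[2] ({w} : Set L)))
    (e : (L ≃ₐ[ℚ_[2]] L) → D) (he0 : ∀ φ, e φ ≠ 0) (he : ∀ φ x, e φ * i x = i (φ x) * e φ) :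
    (∀ k, ∀ x ∈ latticeSpan (i z) (2 ^ n) (fun a => i (b a)) e,
      i z ^ k * x * (i z ^ k)⁻¹ ∈ latticeSpan (i z) (2 ^ n) (fun a => i (b a)) e) ∧
    Module.Finite ℤ (latticeSpan (i z) (2 ^ n) (fun a => i (b a)) e) ∧
    Module.finrank ℤ (latticeSpan (i z) (2 ^ n) (fun a => i (b a)) e) =
      2 ^ n * m ^ 2 * 2 ^ n ∧
    ∃ y : Fin (2 ^ n * m ^ 2) → latticeSpan (i z) (2 ^ n) (fun a => i (b a)) e,
      LinearIndependent ℤ fun p : Fin (2 ^ n * m ^ 2) × Fin (2 ^ n) =>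
        i z ^ (p.2 : ℕ) * (y p.1 : D) * (i z ^ (p.2 : ℕ))⁻¹ := by
  let _ : CommRing L := { ‹Ring L› with mul_comm := hc }
  let _ : Field L := fieldOfFiniteDimensional ℚ_[2] L
  exact latticeSpan_properties_of_field i hm z w hz hw hL b e he0 he

/-- Used to carry the basis of `ℚ_2(w)` from `D` to the smaller algebra generated by `ζ` and `w`. -/
theorem exists_equiv_adjoin_coe {F D : Type*} [Field F] [Ring D] [Algebra F D]
    (A : Subalgebra F D) (w : A) :
    ∃ E : Algebra.adjoin F ({w} : Set A) ≃ₐ[F] Algebra.adjoin F ({(w : D)} : Set D),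
      ∀ x, ((E x : Algebra.adjoin F ({(w : D)} : Set D)) : D) = ((x : A) : D) := by
  have hmap : (Algebra.adjoin F ({w} : Set A)).map A.val = Algebra.adjoin F {(w : D)} :=
    AlgHom.map_adjoin_singleton A.val w
  exact ⟨((Algebra.adjoin F ({w} : Set A)).equivMapOfInjective A.val Subtype.val_injective).trans
    (Subalgebra.equivOfEq _ _ hmap), fun _ => rfl⟩

theorem latticeSpan_properties {D : Type*} [DivisionRing D] [Algebra ℚ_[2] D]
    [FiniteDimensional ℚ_[2] D] {n m : ℕ} (hm : Odd m) (ζ w : D) (hζ : ζ ^ 2 ^ n = -1)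
    (hw : orderOf w = 2 ^ m - 1) (hcomm : Commute ζ w)
    (b : Module.Basis (Fin m) ℚ_[2] (Algebra.adjoin ℚ_[2] ({w} : Set D)))
    (e : (Algebra.adjoin ℚ_[2] ({ζ, w} : Set D) ≃ₐ[ℚ_[2]]
        Algebra.adjoin ℚ_[2] ({ζ, w} : Set D)) → D)
    (he0 : ∀ φ, e φ ≠ 0)
    (he : ∀ φ (x : Algebra.adjoin ℚ_[2] ({ζ, w} : Set D)), e φ * (x : D) = (φ x : D) * e φ) :
    (∀ k, ∀ x ∈ latticeSpan ζ (2 ^ n) (fun a => (b a : D)) e,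
      ζ ^ k * x * (ζ ^ k)⁻¹ ∈ latticeSpan ζ (2 ^ n) (fun a => (b a : D)) e) ∧
    Module.Finite ℤ (latticeSpan ζ (2 ^ n) (fun a => (b a : D)) e) ∧
    Module.finrank ℤ (latticeSpan ζ (2 ^ n) (fun a => (b a : D)) e) =
      2 ^ n * m ^ 2 * 2 ^ n ∧
    ∃ y : Fin (2 ^ n * m ^ 2) → latticeSpan ζ (2 ^ n) (fun a => (b a : D)) e,
      LinearIndependent ℤ fun p : Fin (2 ^ n * m ^ 2) × Fin (2 ^ n) =>
        ζ ^ (p.2 : ℕ) * (y p.1 : D) * (ζ ^ (p.2 : ℕ))⁻¹ := by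
  have hc : ∀ x ∈ ({ζ, w} : Set D), ∀ y ∈ ({ζ, w} : Set D), x * y = y * x := by
    rintro x (rfl | rfl) y (rfl | rfl)
    · rfl
    · exact hcomm
    · exact hcomm.symm
    · rfl
  let A := Algebra.adjoin ℚ_[2] ({ζ, w} : Set D)
  let z' : A := ⟨ζ, Algebra.subset_adjoin (by simp)⟩
  let w' : A := ⟨w, Algebra.subset_adjoin (by simp)⟩
  have hz' : z' ^ 2 ^ n = -1 := by
    refine Subtype.ext ?_
    rw [SubmonoidClass.coe_pow]
    exact hζ
  have hw' : orderOf w' = 2 ^ m - 1 := by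
    rw [← hw, ← orderOf_injective A.val.toMonoidHom Subtype.val_injective w']
    rfl
  have htop : Algebra.adjoin ℚ_[2] {z', w'} = (⊤ : Subalgebra ℚ_[2] A) := by
    rw [← Algebra.adjoin_adjoin_coe_preimage (R := ℚ_[2]) (s := ({ζ, w} : Set D))]
    congr 1
    ext x
    simp [z', w', Subtype.ext_iff]
  obtain ⟨E, hE⟩ := exists_equiv_adjoin_coe A w'
  let b' := b.map E.symm.toLinearEquiv
  have hb' : ∀ a, (((b' a : Algebra.adjoin ℚ_[2] ({w'} : Set A)) : A) : D) = b a := by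
    intro a
    have h1 : b' a = E.symm (b a) := Module.Basis.map_apply _ _ _
    have h2 := hE (E.symm (b a))
    rw [E.apply_symm_apply] at h2
    rw [h1, h2]
  have hfun : (fun a => (b a : D)) = fun a => A.val (b' a) := funext fun a => (hb' a).symm
  rw [hfun]
  refine latticeSpan_properties_of_ring (L := A) (fun x y => ?_) A.val hm z' w' hz' hw' htop b' e
    he0 he
  have := Algebra.isMulCommutative_adjoin ℚ_[2] hc
  exact mul_comm' x y

end Lattice

/-! ### From conjugation by a generator to representations of the cyclic group. -/

section Cyclic

variable {C : Type*} [CommGroup C]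

/-- The `N`-th power squares to `1` but is not `1`, and a division ring has no square roots of `1`
besides `1` and `-1`. -/
theorem unit_pow_eq_neg_one {D : Type*} [DivisionRing D] (u : C →* Dˣ)
    (hu : Function.Injective u) {N : ℕ} (hN : 0 < N) (hC : Nat.card C = 2 * N) {γ : C}
    (hγ : ∀ g : C, g ∈ Subgroup.zpowers γ) : ((u γ : Dˣ) : D) ^ N = -1 := by
  have hord : orderOf γ = 2 * N := by rw [orderOf_eq_card_of_forall_mem_zpowers hγ, hC]
  have hsq : (((u γ : Dˣ) : D) ^ N) * ((u γ : Dˣ) : D) ^ N = 1 := by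
    rw [← pow_add, ← two_mul, ← hord, ← Units.val_pow_eq_pow_val, ← map_pow, pow_orderOf_eq_one,
      map_one, Units.val_one]
  refine (mul_self_eq_one_iff.1 hsq).resolve_left fun h => ?_
  rw [← Units.val_pow_eq_pow_val, ← map_pow, Units.val_eq_one, map_eq_one_iff u hu] at h
  exact pow_ne_one_of_lt_orderOf hN.ne' (by omega) h

variable [Finite C]

theorem nonempty_equiv_of_conj_equiv {D V : Type*} [DivisionRing D] [Algebra ℚ_[2] D]
    [Algebra.IsCentral ℚ_[2] D] [FiniteDimensional ℚ_[2] D] [AddCommGroup V] [Module ℚ_[2] V]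
    {n m : ℕ} (hm : 0 < m) (hD : Module.finrank ℚ_[2] D = (2 ^ n * m) ^ 2)
    (hC : Nat.card C = 2 * 2 ^ n) (h2 : Nat.card (subgroupC₂ C) = 2) {γ : C}
    (hγ : ∀ g : C, g ∈ Subgroup.zpowers γ) (u : C →* Dˣ) (hu : Function.Injective u)
    (ρ : Representation ℚ_[2] C V) (Λ : D ≃ₗ[ℚ_[2]] V)
    (hΛ : ∀ g x, ρ g (Λ x) = Λ ((u g : D) * x * ((u g)⁻¹ : Dˣ))) :
    Nonempty (ρ.Equiv (copies (2 ^ n * m ^ 2) (quotientRegularRep ℚ_[2] C))) := by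
  have hζ := unit_pow_eq_neg_one u hu (by positivity) hC hγ
  have hpow : ∀ (k : ℕ) (x : D), ρ (γ ^ k) (Λ x) =
      Λ ((u γ : D) ^ k * x * ((u γ : D) ^ k)⁻¹) := fun k x => by
    rw [hΛ, Units.val_inv_eq_inv_val, map_pow, Units.val_pow_eq_pow_val]
  obtain ⟨y, hy⟩ := exists_linearIndependent_conj_pow_padic hD (u γ : D) hζ
  refine nonempty_equiv_of_linearIndependent ρ (2 ^ n * m ^ 2) (2 ^ n) (by positivity)
    (by positivity) hC h2 γ hγ ?_ (fun i => Λ (y i)) ?_ ?_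
  · ext x
    obtain ⟨x, rfl⟩ := Λ.surjective x
    rw [hpow, hζ]
    simp
  · simp only [hpow]
    exact hy.map' Λ.toLinearMap Λ.ker
  · rw [← Λ.finrank_eq, hD]
    ring

theorem exists_nonempty_realification_equiv {D : Type*} [DivisionRing D] [CharZero D]
    {M N : ℕ} (hM : 0 < M) (hN : 0 < N)
    (hC : Nat.card C = 2 * N) (h2 : Nat.card (subgroupC₂ C) = 2) {γ : C}
    (hγ : ∀ g : C, g ∈ Subgroup.zpowers γ) (u : C →* Dˣ) (hu : Function.Injective u)
    (ℰ : Submodule ℤ D) [Module.Finite ℤ ℰ]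
    (hst : ∀ k : ℕ, ∀ x ∈ ℰ, (u γ : D) ^ k * x * ((u γ : D) ^ k)⁻¹ ∈ ℰ)
    (hrank : Module.finrank ℤ ℰ = M * N) (y : Fin M → ℰ)
    (hy : LinearIndependent ℤ fun p : Fin M × Fin N =>
      (u γ : D) ^ (p.2 : ℕ) * (y p.1 : D) * ((u γ : D) ^ (p.2 : ℕ))⁻¹) :
    ∃ hst : ∀ g : C, ℰ ≤ ℰ.comap (((conjRep D).comp u) g),
      Nonempty ((realification (Representation.subrepresentation _ ℰ hst)).Equiv
        (copies M (quotientRegularRep ℝ C))) := by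
  have hζ := unit_pow_eq_neg_one u hu hN hC hγ
  have hpow : ∀ (k : ℕ) (x : D), ((conjRep D).comp u) (γ ^ k) x =
      (u γ : D) ^ k * x * ((u γ : D) ^ k)⁻¹ := fun k x => by
    rw [← Units.val_pow_eq_pow_val, ← Units.val_inv_eq_inv_val, ← map_pow]
    rfl
  have hst' : ∀ g : C, ℰ ≤ ℰ.comap (((conjRep D).comp u) g) := by
    intro g x hx
    obtain ⟨k, rfl⟩ := (mem_powers_iff_mem_zpowers (x := γ)).2 (hγ g)
    exact (congrArg (· ∈ ℰ) (hpow k x)).mpr (hst k x hx)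
  refine ⟨hst', nonempty_realification_equiv _ M N hN hM hC h2 γ hγ ?_ y ?_ hrank⟩
  · ext x
    refine (hpow N x).trans ?_
    simp [hζ]
  · refine LinearIndependent.of_comp ℰ.subtype ?_
    have : (ℰ.subtype ∘ fun p : Fin M × Fin N =>
        (Representation.subrepresentation ((conjRep D).comp u) ℰ hst') (γ ^ (p.2 : ℕ)) (y p.1)) =
        fun p : Fin M × Fin N =>
          (u γ : D) ^ (p.2 : ℕ) * (y p.1 : D) * ((u γ : D) ^ (p.2 : ℕ))⁻¹ :=
      funext fun p => hpow p.2 (y p.1)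
    rw [this]
    exact hy

end Cyclic

end Morava

end

/-! ### The main theorem. -/

theorem theoremA
    (n m h : ℕ) (hn : 2 ≤ n) (hm : Odd m) (hh : h = 2 ^ (n - 1) * m)
    {D : Type*} [NormedDivisionRing D] [NormedAlgebra ℚ_[2] D] [FiniteDimensional ℚ_[2] D]
    (hD : Morava.HasHasseInvariantOneDiv 2 h D)
    {E : Type*} [NormedAddCommGroup E] [NormedSpace ℚ_[2] E]
    {G : Type*} [TopologicalSpace G] [Group G] [ChartedSpace E G] [LieGroup 𝓘(ℚ_[2], E) ω G]
    (j : Morava.Stabilizer 2 D →* G) (hj : Function.Injective j)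
    (hjd : IsLocalDiffeomorph 𝓘(ℚ_[2], D) 𝓘(ℚ_[2], E) ω j)
    {C : Type*} [CommGroup C] [Finite C] [IsCyclic C] (hC : Nat.card C = 2 ^ n)
    (ι : C →* Morava.Stabilizer 2 D) (hι : Function.Injective ι) :
    -- the `2`-adic Lie algebra of `G` with the adjoint action of `C`
    (Nonempty (Representation.Equiv
        (Representation.prod ((Morava.adjointRep 𝓘(ℚ_[2], E) G).comp (j.comp ι))
          (Morava.copies (2 ^ (n - 1) * m ^ 2) (Morava.indSign ℚ_[2] C)))
        (Morava.copies (2 ^ (n - 1) * m ^ 2) (Representation.leftRegular ℚ_[2] C))) ∧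
      Nonempty (Representation.Equiv
        ((Morava.adjointRep 𝓘(ℚ_[2], E) G).comp (j.comp ι))
        (Morava.copies (h ^ 2 / 2 ^ (n - 1)) (Morava.quotientRegularRep ℚ_[2] C)))) ∧
    -- the real representation spanned by the lattice `ℰ`, with the conjugation action of `C`
    ∀ (γ : C) (_ : ∀ g : C, g ∈ Subgroup.zpowers γ)
      (ζ : D) (_ : ζ = (Morava.Stabilizer.toUnits 2 D (ι γ) : D))
      (w : D) (_ : orderOf w = 2 ^ m - 1) (_ : Commute ζ w)
      (b : Module.Basis (Fin m) ℚ_[2] (Algebra.adjoin ℚ_[2] ({w} : Set D)))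
      (e : (Algebra.adjoin ℚ_[2] ({ζ, w} : Set D) ≃ₐ[ℚ_[2]]
        Algebra.adjoin ℚ_[2] ({ζ, w} : Set D)) → D)
      (_ : ∀ φ, e φ ≠ 0)
      (_ : ∀ φ (x : Algebra.adjoin ℚ_[2] ({ζ, w} : Set D)), e φ * (x : D) = (φ x : D) * e φ)
      (ℰ : Submodule ℤ D)
      (_ : ℰ = Morava.latticeSpan ζ (2 ^ (n - 1)) (fun a => (b a : D)) e),
      ∃ hst : ∀ g : C, ℰ ≤ ℰ.comap
          (((Morava.conjRep D).comp ((Morava.Stabilizer.toUnits 2 D).comp ι)) g),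
        Nonempty (Representation.Equiv
          (Representation.prod (Morava.realification (Representation.subrepresentation _ ℰ hst))
            (Morava.copies (2 ^ (n - 1) * m ^ 2) (Morava.indSign ℝ C)))
          (Morava.copies (2 ^ (n - 1) * m ^ 2) (Representation.leftRegular ℝ C))) ∧
        Nonempty (Representation.Equiv
          (Morava.realification (Representation.subrepresentation _ ℰ hst))
          (Morava.copies (h ^ 2 / 2 ^ (n - 1)) (Morava.quotientRegularRep ℝ C))) := by
  -- The lemmas are stated for the exponent `k = n - 1`, for which `ζ ^ 2 ^ k = -1`.
  generalize hk : n - 1 = k at *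
  obtain rfl : n = k + 1 := by omega
  subst hh
  have hdiv : (2 ^ k * m) ^ 2 / 2 ^ k = 2 ^ k * m ^ 2 :=
    Nat.div_eq_of_eq_mul_left (by positivity) (by ring)
  have hC' : Nat.card C = 2 * 2 ^ k := by rw [hC, pow_succ']
  have h2 : Nat.card (Morava.subgroupC₂ C) = 2 :=
    Morava.card_subgroupC₂ (hC' ▸ Dvd.intro _ rfl)
  have hM : 0 < 2 ^ k * m ^ 2 := Nat.mul_pos (by positivity) (pow_pos hm.pos 2)
  have hu : Function.Injective ((Morava.Stabilizer.toUnits 2 D).comp ι) :=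
    (Units.map_injective (f := (Morava.maximalOrder 2 D).subtype.toMonoidHom)
      Subtype.val_injective).comp hι
  have := hD.isCentral
  have : CharZero D := charZero_of_injective_algebraMap (algebraMap ℚ_[2] D).injective
  generalize (2 ^ k * m) ^ 2 / 2 ^ k = M at hdiv ⊢
  subst hdiv
  refine ⟨?_, ?_⟩
  · obtain ⟨γ, hγ⟩ := IsCyclic.exists_generator (α := C)
    obtain ⟨Λ, hΛ⟩ := Morava.exists_linearEquiv_groupLieAlgebra 2 D j hjd
    obtain ⟨f⟩ := Morava.nonempty_equiv_of_conj_equiv hm.pos hD.finrank_eq hC' h2 hγ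
      ((Morava.Stabilizer.toUnits 2 D).comp ι) hu
      ((Morava.adjointRep 𝓘(ℚ_[2], E) G).comp (j.comp ι)) Λ fun g x => hΛ (ι g) x
    exact ⟨Morava.nonempty_prod_indSign_equiv two_ne_zero h2 f, ⟨f⟩⟩
  · rintro γ hγ ζ rfl w hw hcomm b e he0 he ℰ rfl
    obtain ⟨hst, _, hrank, y, hy⟩ := Morava.latticeSpan_properties hm _ _
      (Morava.unit_pow_eq_neg_one _ hu (by positivity) hC' hγ) hw hcomm b e he0 he
    obtain ⟨hst', ⟨f⟩⟩ := Morava.exists_nonempty_realification_equiv hM (by positivity) hC' h2 hγ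
      ((Morava.Stabilizer.toUnits 2 D).comp ι) hu _ hst hrank y hy
    exact ⟨hst', Morava.nonempty_prod_indSign_equiv two_ne_zero h2 f, ⟨f⟩⟩
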